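/- Let $M\ge 1$. For $k\ge 0$ let $B_k$ be the $U_q'(A^{(1)}_M)$-crystal of the $k$-fold symmetric tensor representation, i.e. the set of one-row semistandard tableaux of length $k$ in the letters $1,\dots,M+1$, written by multiplicities as $(x_1,\dots,x_{M+1})$, with Kashiwara operators $\tilde e_i,\tilde f_i$ ($0\le i\le M$): $\tilde e_i$ changes one letter $i+1$ into $i$ (for $i=0$: one letter $1$ into $M+1$), $\tilde f_i$ does the reverse, and the result is $0$ if this is impossible. On tensor products $\tilde e_i$ acts on the left factor of $b\otimes b'$ if $\varphi_i(b)\ge\varepsilon_i(b')$ and on the right factor otherwise, and $\tilde f_i$ acts on the left factor if $\varphi_i(b)>\varepsilon_i(b')$ and on the right factor otherwise. Let $u_k=(k,0,\dots,0)$ and let $R:B_\kappa\otimes B_\theta\to B_\theta\otimes B_\kappa$ be the combinatorial $R$ matrix, i.e. the isomorphism of crystals. Let $B'_k$ be the set of one-row semistandard tableaux of length $k$ in the letters $1,\dots,M$. Let $(\theta_n)_{n\in\mathbb Z}$ be positive integers. A state is $p=\cdots\otimes b_n\otimes b_{n+1}\otimes\cdots$ with $b_n\in B_{\theta_n}$.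 We write $T_\kappa(p)=\cdots\otimes b'_n\otimes b'_{n+1}\otimes\cdots$ if there are $v_n\in B_\kappa$ ($n\in\mathbb Z$) with $v_n=u_\kappa$ for all $n\ll0$ and all $n\gg0$ and $R(v_n\otimes b_n)=b'_n\otimes v_{n+1}$ for all $n$. Divide the cells of the line, numbered by $\mathbb Z$, into consecutive boxes, the $n$-th box having $\theta_n$ cells. For tableaux $b=m_1\cdots m_l\in B'_l$ and $c=m'_1\cdots m'_k\in B'_k$, a starting cell $x\in\mathbb Z$ and $L\in\mathbb Z_{\ge0}$, fill the cells from $x$ on with the letters $m_l+1,\dots,m_1+1$, then $L$ letters $1$, then $m'_k+1,\dots,m'_1+1$, and fill all other cells with $1$; sorting the letters in each box into a tableau gives a state $\iota_{l,k}(b\otimes c)=\iota^{x,L}_{l,k}(b\otimes c)$. It has separation at least $D$ if the letters from $b$ lie in boxes $n_1,\dots,n_1'$ and those from $c$ lie in boxes $n_2,\dots,n_2'$ with $n_2-n_1'\ge D$. An asymptotic two-soliton state is such a state with sufficiently large separation. **Proposition.** For every $l$ there are constants $K_0$ and $D_0$, depending only on $l$, with the following property. Let $M\ge1$, $1\le k<l$,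 $0\le h\le k$ (with $h=k$ if $M=1$), and suppose that $\theta_n<l$ for all but finitely many $n$. Put $$b_1=(l,0,\dots,0)\in B'_l,\quad b_2=(h,k-h,0,\dots,0)\in B'_k,\quad c_2=(k,0,\dots,0)\in B'_k,\quad c_1=(l-k+h,k-h,0,\dots,0)\in B'_l .$$ Let $\kappa\ge K_0$ and let $p=\iota_{l,k}(b_1\otimes b_2)$ be a state, for some $x$ and $L$, with separation at least $D_0$. Then for every $D$ there is $t>0$ such that, for some $x'$ and $L'$, $$T_\kappa^t(p)=\iota^{x',L'}_{k,l}(c_2\otimes c_1)$$ with separation at least $D$. -/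

import Mathlib

namespace SolitonAutomaton

/-- Single-row semistandard tableaux of length `k` on `n` letters, recorded by the multiplicities
of the letters: `b.mult j` is the number of occurrences of the `(j+1)`-st letter.
As a set, the crystal `B_k` of `U'_q(A^{(1)}_M)` is `Row (M + 1) k`, and the crystal `B'_k` of
`U'_q(A^{(1)}_{M-1})` is `Row M k`. -/
@[ext]
structure Row (n k : ℕ) where
  mult : Fin n → ℕ
  sum_mult : ∑ j, mult j = k

namespace Row

/-- Replace one letter `a` of the row by the letter `c`. -/
def replace {n k : ℕ} (b : Row n k) (a c : Fin n) (h : b.mult a ≠ 0) : Row n k where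
  mult j := (b.mult j - if j = a then 1 else 0) + if j = c then 1 else 0
  sum_mult := by
    have h1 : ∀ j, (b.mult j - if j = a then 1 else 0) + (if j = a then 1 else 0) = b.mult j := by
      intro j
      split_ifs with hj
      · subst hj
        omega
      · simp
    have h2 := b.sum_mult
    rw [← Finset.sum_congr rfl (fun j _ => h1 j), Finset.sum_add_distrib] at h2
    rw [Finset.sum_add_distrib]
    simpa using h2

/-- The highest weight element `u_k`: all the letters are the first one. -/
def u (M k : ℕ) : Row (M + 1) k where
  mult j := if j = 0 then k else 0
  sum_mult := by simp

/-- The Kashiwara operator `ẽ_i` on `B_k`, `i = 0, …, M`, with `none` in the role of `0`.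
With the letters numbered from `0` to `M` it replaces a letter `i` by `i - 1`, where `0 - 1` is
read cyclically as `M`. -/
def e {M k : ℕ} (i : Fin (M + 1)) (b : Row (M + 1) k) : Option (Row (M + 1) k) :=
  if h : b.mult i = 0 then none else some (b.replace i (i - 1) h)

/-- The Kashiwara operator `f̃_i` on `B_k`; it replaces a letter `i - 1` (cyclically) by `i`. -/
def f {M k : ℕ} (i : Fin (M + 1)) (b : Row (M + 1) k) : Option (Row (M + 1) k) :=
  if h : b.mult (i - 1) = 0 then none else some (b.replace (i - 1) i h)

/-- `ε_i(b)`, the number of times `ẽ_i` can be applied to `b`. -/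
def eps {M k : ℕ} (i : Fin (M + 1)) (b : Row (M + 1) k) : ℕ := b.mult i

/-- `φ_i(b)`, the number of times `f̃_i` can be applied to `b`. -/
def phi {M k : ℕ} (i : Fin (M + 1)) (b : Row (M + 1) k) : ℕ := b.mult (i - 1)

/-- The entries `m_1 ≤ ⋯ ≤ m_k` of the tableau, from left to right. -/
def entries {n k : ℕ} (b : Row n k) : List (Fin n) :=
  (List.finRange n).flatMap fun a => List.replicate (b.mult a) a

/-- The row `(a, c, 0, …, 0)`. When there is only one letter, `c` has to be `0`. -/
def IsTwoLetter {n k : ℕ} (b : Row n k) (a c : ℕ) : Prop :=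
  (∀ j, b.mult j = if j.val = 0 then a else if j.val = 1 then c else 0) ∧ a + c = k

end Row

/-- The Kashiwara operator `ẽ_i` on the tensor product `B_k ⊗ B_l`. -/
def tensorE {M k l : ℕ} (i : Fin (M + 1)) (p : Row (M + 1) k × Row (M + 1) l) :
    Option (Row (M + 1) k × Row (M + 1) l) :=
  if p.2.eps i ≤ p.1.phi i then (p.1.e i).map fun b => (b, p.2)
  else (p.2.e i).map fun b => (p.1, b)

/-- The Kashiwara operator `f̃_i` on the tensor product `B_k ⊗ B_l`. -/
def tensorF {M k l : ℕ} (i : Fin (M + 1)) (p : Row (M + 1) k × Row (M + 1) l) :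
    Option (Row (M + 1) k × Row (M + 1) l) :=
  if p.2.eps i < p.1.phi i then (p.1.f i).map fun b => (b, p.2)
  else (p.2.f i).map fun b => (p.1, b)

/-- `Ψ` is an isomorphism of `U'_q(A^{(1)}_M)`-crystals `B_k ⊗ B_l → B_l ⊗ B_k`: a bijection that
commutes with all the Kashiwara operators, `i = 0` included. For `M ≥ 1` the crystals are connected
and there is exactly one such map, the combinatorial `R` matrix. -/
def IsCrystalIso {M k l : ℕ}
    (Ψ : Row (M + 1) k × Row (M + 1) l ≃ Row (M + 1) l × Row (M + 1) k) : Prop :=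
  ∀ i p, tensorE i (Ψ p) = (tensorE i p).map Ψ ∧ tensorF i (Ψ p) = (tensorF i p).map Ψ

/-- `v ⊗ b ≃ b' ⊗ v'`: the combinatorial `R` matrix maps `v ⊗ b` to `b' ⊗ v'`. -/
def RMatrixMaps {M k l : ℕ} (v : Row (M + 1) k) (b : Row (M + 1) l)
    (b' : Row (M + 1) l) (v' : Row (M + 1) k) : Prop :=
  ∃ Ψ : Row (M + 1) k × Row (M + 1) l ≃ Row (M + 1) l × Row (M + 1) k,
    IsCrystalIso Ψ ∧ Ψ (v, b) = (b', v')

/-- States `⋯ ⊗ b_n ⊗ b_{n+1} ⊗ ⋯` with `b_n ∈ B_{θ_n}`. -/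
abbrev State (M : ℕ) (θ : ℤ → ℕ) : Type := ∀ n : ℤ, Row (M + 1) (θ n)

/-- `T_κ(p) = q`: sending the carrier `u_κ` through `p` from the far left, the carrier `v n` and the
content `p n` of the `n`-th box become `q n` and `v (n + 1)` under the combinatorial `R` matrix,
and the carrier finally returns to `u_κ`. -/
def TimeStep {M : ℕ} {θ : ℤ → ℕ} (κ : ℕ) (p q : State M θ) : Prop :=
  ∃ v : ℤ → Row (M + 1) κ,
    (∀ᶠ n in Filter.atBot, v n = Row.u M κ) ∧ (∀ᶠ n in Filter.atTop, v n = Row.u M κ) ∧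
      ∀ n, RMatrixMaps (v n) (p n) (q n) (v (n + 1))

/-- `T_κ^t(p) = q`. -/
def TimeEvolution {M : ℕ} {θ : ℤ → ℕ} (κ t : ℕ) (p q : State M θ) : Prop :=
  ∃ s : ℕ → State M θ, s 0 = p ∧ s t = q ∧ ∀ i < t, TimeStep κ (s i) (s (i + 1))

/-- The unit cells of the line are numbered by the integers, and the `n`-th box consists of the
`θ n` consecutive cells from `boxStart θ n` to `boxStart θ (n + 1) - 1`; box `0` starts at `0`. -/
noncomputable def boxStart (θ : ℤ → ℕ) (n : ℤ) : ℤ :=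
  (∑ j ∈ Finset.Ico 0 n, (θ j : ℤ)) - ∑ j ∈ Finset.Ico n 0, (θ j : ℤ)

/-- The map `θ̂ = ⋯ ⊗ ς_{θ_n} ⊗ ς_{θ_{n+1}} ⊗ ⋯`: the letters of `w` (elements of `B_1`) in the
cells of the `n`-th box are sorted into an element of `B_{θ_n}`. -/
noncomputable def group {M : ℕ} (θ : ℤ → ℕ) (w : ℤ → Fin (M + 1)) : State M θ := fun n =>
  { mult := fun a => ((Finset.range (θ n)).filter fun j : ℕ => w (boxStart θ n + j) = a).card
    sum_mult := by
      rw [← Finset.card_eq_sum_card_fiberwise (fun _ _ => Finset.mem_coe.2 (Finset.mem_univ _)),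
        Finset.card_range] }

/-- `ı_k(m_1 ⋯ m_k) = (m_k + 1) ⊗ ⋯ ⊗ (m_1 + 1)`. -/
def solitonWord {M k : ℕ} (b : Row M k) : List (Fin (M + 1)) :=
  (b.entries.map Fin.succ).reverse

/-- The image of `b ⊗ c` under `ι^{(L_0, L_1, L_2)}_{l,k}` on the infinite line: the soliton `b`
begins at the cell `x` (which takes the place of `L_0`), the soliton `c` follows after `L` cells
with the first letter, and all other cells hold the first letter. -/
noncomputable def twoSoliton {M l k : ℕ} (θ : ℤ → ℕ) (x : ℤ) (L : ℕ) (b : Row M l) (c : Row M k) : State M θ :=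
  group θ fun p =>
    if x ≤ p then
      (solitonWord b ++ List.replicate L 0 ++ solitonWord c).getD (p - x).toNat 0
    else 0

/-- `p` is the two-soliton state built from `b ⊗ c`, where the soliton `b` lies in the boxes
`n₁, …, n₁'` and the soliton `c` in the boxes `n₂, …, n₂'` with `n₂ - n₁' ≥ D`
(so all the boxes outside the two segments hold `u`). -/
def IsSeparatedTwoSoliton {M l k : ℕ} {θ : ℤ → ℕ} (D : ℕ) (b : Row M l) (c : Row M k)
    (p : State M θ) : Prop :=
  ∃ (x : ℤ) (L : ℕ), p = twoSoliton θ x L b c ∧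
    ∃ n₁ n₁' n₂ n₂' : ℤ, n₁ ≤ n₁' ∧ n₂ ≤ n₂' ∧ (D : ℤ) ≤ n₂ - n₁' ∧
      boxStart θ n₁ ≤ x ∧ x + l ≤ boxStart θ (n₁' + 1) ∧
      boxStart θ n₂ ≤ x + l + L ∧ x + l + L + k ≤ boxStart θ (n₂' + 1)

end SolitonAutomaton

/-! The state turns out to be an exact two-soliton solution with a closed formula, so the collision
is read off from its asymptotics rather than followed step by step.

Put `s = k - h`; only the letters 1, 2, 3 occur. The combinatorial R matrix is realised by a
piecewise-linear bijection (`RGraph`) that commutes with every `ẽ_i` (`RGraph.tensorE`). For a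
carrier with room for all the balls it reduces to a simple rule: the box takes 3s from the carrier
into the places of its 1s, then takes 2s into the places that held no 2 and received no 3
(`rMatrixMaps_of_hasBalls`).

The numbers of 2s and 3s to the right of a point are differences of the functions `tau`, where the
phases `ξ`, `η` of the two solitons grow by `l`, `k` per time step and drop by `min θ_n l`, `min θ_n
k` across box `n`. Box contents are differences of these counts in space and carriers are
differences in time, so letter conservation is automatic, and the rule becomes two max-plus bilinear
identities, `hirota_first` and `hirota_second`.

Away from the collision `tau` degenerates. When the short soliton is ahead, it sits at `η` and
carries the `s` letters 3, and the long one sits at `ξ - (2k - s)`; when the long one is ahead, it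
sits at `ξ` and carries the 3s, and the short one sits at `η - (2k - s)`. It remains to fit the
phase constants to the initial state (`exists_isSolution_initial`) and to see that the order is
eventually reversed. The latter holds because `l * min θ_n k - k * min θ_n l ≥ 1` whenever `θ_n < l`
(`exists_time_phase_ge`). -/

namespace SolitonAutomaton

/-! ### The piecewise-linear R matrix as a bijection -/

/-- The cyclic Lindley recursion, saturated somewhere, whose solution determines the
combinatorial `R` matrix on `x ⊗ y` when `y` is not longer than `x`. -/
def IsProfile {M : ℕ} (x y : Fin (M + 1) → ℤ) (θ : ℤ) (Q : Fin (M + 1) → ℤ) : Prop :=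
  (∀ i, y i + Q (i - 1) = min θ (x i + Q i)) ∧ ∃ i, θ ≤ x i + Q i

lemma Fin.val_nsmul_one {M : ℕ} (j : Fin (M + 1)) : j.val • (1 : Fin (M + 1)) = j := by
  have h : ∀ m : ℕ, (m • (1 : Fin (M + 1))).val = m % (M + 1) := by
    intro m
    induction m with
    | zero => simp
    | succ m ih =>
      rw [succ_nsmul, Fin.val_add, ih]
      simp
  apply Fin.ext
  rw [h, Nat.mod_eq_of_lt j.isLt]

lemma sum_range_nsmul_one {M : ℕ} (f : Fin (M + 1) → ℤ) (i : Fin (M + 1)) :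
    ∑ j ∈ Finset.range (M + 1), f (i + j • 1) = ∑ j, f j := by
  rw [Finset.sum_range (fun j : ℕ => f (i + j • 1))]
  simp_rw [Fin.val_nsmul_one]
  exact Equiv.sum_comp (Equiv.addLeft i) f

/-- The partial sums of the cyclic walk with steps `x (i + 1) - y (i + 1 + 1), …`. -/
def walk {M : ℕ} (x y : Fin (M + 1) → ℤ) (i : Fin (M + 1)) (m : ℕ) : ℤ :=
  ∑ j ∈ Finset.range m, (x (i + 1 + j • 1) - y (i + 1 + 1 + j • 1))

lemma walk_pred_succ {M : ℕ} (x y : Fin (M + 1) → ℤ) (i : Fin (M + 1)) (m : ℕ) :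
    walk x y (i - 1) (m + 1) = x i - y (i + 1) + walk x y i m := by
  unfold walk
  rw [Finset.sum_range_succ', add_comm]
  congr 1
  · congr 2 <;> simp
  · apply Finset.sum_congr rfl
    intro j _
    congr 2 <;> (rw [succ_nsmul]; abel)

/-- The recursion is solved by minima of partial sums, as for a queue: up to an affine change, `Q i`
is the least value `W i` of the cyclic walk started after `i`. The hypothesis on the sums says that
a full turn of the walk does not descend, so one period suffices for the minimum. -/
lemma exists_isProfile {M : ℕ} (x y : Fin (M + 1) → ℤ) (θ : ℤ) (hy : ∑ i, y i = θ)
    (hx : θ ≤ ∑ i, x i) : ∃ Q, IsProfile x y θ Q := by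
  have hne : (Finset.range (M + 1)).Nonempty := ⟨0, by simp⟩
  set W : Fin (M + 1) → ℤ := fun i => (Finset.range (M + 1)).inf' hne (walk x y i) with hW
  have hfull : ∀ i, 0 ≤ walk x y i (M + 1) := by
    intro i
    unfold walk
    rw [Finset.sum_sub_distrib, sum_range_nsmul_one, sum_range_nsmul_one]
    omega
  have hrec : ∀ i, W (i - 1) = min 0 (x i - y (i + 1) + W i) := by
    intro i
    apply le_antisymm
    · apply le_min
      · have := Finset.inf'_le (s := Finset.range (M + 1)) (walk x y (i - 1)) (b := 0) (by simp)
        exact this.trans_eq (by simp [walk])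
      · obtain ⟨m, hm, hm2⟩ := Finset.exists_mem_eq_inf' hne (walk x y i)
        simp only [hW]
        rw [hm2, ← walk_pred_succ]
        rcases Nat.lt_or_ge (m + 1) (M + 1) with h | h
        · exact Finset.inf'_le _ (by simpa using h)
        -- The minimiser completes a full turn; that value is nonnegative, hence no better than the
        -- empty walk.
        · have h3 : m + 1 = M + 1 := by
            have := Finset.mem_range.1 hm
            omega
          rw [h3]
          refine le_trans ?_ (hfull _)
          have := Finset.inf'_le (s := Finset.range (M + 1)) (walk x y (i - 1)) (b := 0) (by simp)
          exact this.trans_eq (by simp [walk])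
    · simp only [hW]
      apply Finset.le_inf'
      intro m hm
      cases m with
      | zero => simp [walk]
      | succ m =>
        rw [walk_pred_succ]
        apply le_trans (min_le_right _ _)
        have := Finset.inf'_le (s := Finset.range (M + 1)) (walk x y i) (b := m)
          (by have := Finset.mem_range.1 hm; simp; omega)
        linarith
  have hQ : ∀ i, y i + (θ - y (i - 1 + 1) + W (i - 1)) = min θ (x i + (θ - y (i + 1) + W i)) := by
    intro i
    rw [hrec, sub_add_cancel]
    omega
  refine ⟨fun i => θ - y (i + 1) + W i, hQ, ?_⟩
  -- Without saturation every step of the walk equals `W i - W (i + 1)`, so the walk from 0 is `W 0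
  -- - W m`. At a minimiser this forces `W m = 0`, and the equation there reads `θ = min θ _`, which
  -- is saturation.
  by_contra hcon
  push Not at hcon
  have hg : ∀ i, x (i + 1) - y (i + 1 + 1) = W i - W (i + 1) := by
    intro i
    have h1 := hQ (i + 1)
    have h2 := hcon (i + 1)
    rw [add_sub_cancel_right] at h1
    omega
  have hsum : ∀ m, walk x y 0 m = W 0 - W (m • 1) := by
    intro m
    induction m with
    | zero => simp [walk]
    | succ m ih =>
      have : walk x y 0 (m + 1) = walk x y 0 m + (x (m • 1 + 1) - y (m • 1 + 1 + 1)) := by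
        unfold walk
        rw [Finset.sum_range_succ]
        congr 3 <;> abel
      rw [this, ih, hg, succ_nsmul]
      ring
  obtain ⟨m, hm, hm2⟩ := Finset.exists_mem_eq_inf' hne (walk x y 0)
  have h0 : W 0 = walk x y 0 m := hm2
  rw [hsum] at h0
  have h1 := hQ (m • 1 + 1)
  have h2 := hcon (m • 1 + 1)
  rw [add_sub_cancel_right] at h1
  omega

/-- At a saturated index of `Q` the value `Q (i - 1) = θ - y i` is the largest that the recursion
allows. The recursion is monotone, so the comparison propagates around the circle. -/
lemma IsProfile.le {M : ℕ} {x y : Fin (M + 1) → ℤ} {θ : ℤ} {P Q : Fin (M + 1) → ℤ}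
    (hP : IsProfile x y θ P) (hQ : IsProfile x y θ Q) (j : Fin (M + 1)) : P j ≤ Q j := by
  obtain ⟨i, hi⟩ := hQ.2
  have key : ∀ m : ℕ, P (i - 1 - m • 1) ≤ Q (i - 1 - m • 1) := by
    intro m
    induction m with
    | zero =>
      have h1 := hP.1 i
      have h2 := hQ.1 i
      simp only [zero_nsmul, sub_zero]
      omega
    | succ m ih =>
      have h1 := hP.1 (i - 1 - m • 1)
      have h2 := hQ.1 (i - 1 - m • 1)
      rw [succ_nsmul, ← sub_sub]
      omega
  have := key (i - 1 - j).val
  rwa [Fin.val_nsmul_one, sub_sub_cancel] at this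

lemma IsProfile.unique {M : ℕ} {x y : Fin (M + 1) → ℤ} {θ : ℤ} {P Q : Fin (M + 1) → ℤ}
    (hP : IsProfile x y θ P) (hQ : IsProfile x y θ Q) : P = Q :=
  funext fun j => le_antisymm (hP.le hQ j) (hQ.le hP j)

/-- The graph of the combinatorial `R` matrix `x ⊗ y ↦ y' ⊗ x'` for `θ ≤ κ`. -/
def RGraph {M κ θ : ℕ} (x : Row (M + 1) κ) (y y' : Row (M + 1) θ) (x' : Row (M + 1) κ) : Prop :=
  ∃ Q : Fin (M + 1) → ℤ, (∀ i, (y'.mult i : ℤ) = y.mult i + Q (i - 1) - Q i) ∧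
    (∀ i, (x'.mult i : ℤ) = x.mult i + Q i - Q (i - 1)) ∧
    IsProfile (fun i => (x.mult i : ℤ)) (fun i => (y.mult i : ℤ)) θ Q

lemma Row.sum_mult_int {n k : ℕ} (b : Row n k) : ∑ i, (b.mult i : ℤ) = k := by
  exact_mod_cast b.sum_mult

lemma exists_row_of_int {n k : ℕ} (g : Fin n → ℤ) (h0 : ∀ i, 0 ≤ g i) (hs : ∑ i, g i = k) :
    ∃ b : Row n k, ∀ i, (b.mult i : ℤ) = g i := by
  refine ⟨⟨fun i => (g i).toNat, ?_⟩, fun i => Int.toNat_of_nonneg (h0 i)⟩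
  zify
  rw [← hs]
  exact Finset.sum_congr rfl fun i _ => Int.toNat_of_nonneg (h0 i)

lemma sum_shift {M : ℕ} (Q : Fin (M + 1) → ℤ) : ∑ i, Q (i - 1) = ∑ i, Q i :=
  Equiv.sum_comp (Equiv.subRight 1) Q

lemma RGraph.exists_image {M κ θ : ℕ} (h : θ ≤ κ) (x : Row (M + 1) κ) (y : Row (M + 1) θ) :
    ∃ y' x', RGraph x y y' x' := by
  obtain ⟨Q, hQ⟩ := exists_isProfile (fun i => (x.mult i : ℤ)) (fun i => (y.mult i : ℤ)) θ
    y.sum_mult_int (by rw [x.sum_mult_int]; exact_mod_cast h)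
  obtain ⟨y', hy'⟩ := exists_row_of_int (k := θ) (fun i => (y.mult i : ℤ) + Q (i - 1) - Q i)
    (by
      intro i
      have h1 := hQ.1 i
      have h2 := hQ.1 (i + 1)
      simp only [add_sub_cancel_right] at h1 h2
      omega)
    (by rw [Finset.sum_sub_distrib, Finset.sum_add_distrib, sum_shift, y.sum_mult_int]; ring)
  obtain ⟨x', hx'⟩ := exists_row_of_int (k := κ) (fun i => (x.mult i : ℤ) + Q i - Q (i - 1))
    (by
      intro i
      have h1 := hQ.1 i
      simp only at h1
      omega)
    (by rw [Finset.sum_sub_distrib, Finset.sum_add_distrib, sum_shift, x.sum_mult_int]; ring)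
  exact ⟨y', x', Q, hy', hx', hQ⟩

lemma RGraph.image_unique {M κ θ : ℕ} {x : Row (M + 1) κ} {y y₁ y₂ : Row (M + 1) θ}
    {x₁ x₂ : Row (M + 1) κ} (h₁ : RGraph x y y₁ x₁) (h₂ : RGraph x y y₂ x₂) :
    y₁ = y₂ ∧ x₁ = x₂ := by
  obtain ⟨Q, hy, hx, hQ⟩ := h₁
  obtain ⟨P, hy', hx', hP⟩ := h₂
  obtain rfl := hQ.unique hP
  constructor <;> ext i
  · have := hy i; have := hy' i; omega
  · have := hx i; have := hx' i; omega

/-- The inverse map is given by the same recursion with the cyclic order reversed. Existence and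
uniqueness of preimages therefore follow from the statements for images. -/
lemma isProfile_reflect {M : ℕ} {x y x' y' Q : Fin (M + 1) → ℤ} {θ : ℤ}
    (hy : ∀ i, y' i = y i + Q (i - 1) - Q i) (hx : ∀ i, x' i = x i + Q i - Q (i - 1)) :
    IsProfile (fun i => x' (-i)) (fun i => y' (-i)) θ (fun i => Q (-i - 1)) ↔
      IsProfile x y θ Q := by
  have e : ∀ i : Fin (M + 1), -(i - 1) - 1 = -i := fun i => by abel
  have h1 : ∀ i, y' i + Q i = y i + Q (i - 1) := fun i => by rw [hy]; ring
  have h2 : ∀ i, x' i + Q (i - 1) = x i + Q i := fun i => by rw [hx]; ring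
  unfold IsProfile
  simp only [e, h1, h2]
  constructor
  · rintro ⟨h, i, hi⟩
    exact ⟨fun j => by simpa using h (-j), -i, hi⟩
  · rintro ⟨h, i, hi⟩
    exact ⟨fun j => h (-j), -i, by simpa using hi⟩

lemma RGraph.exists_preimage {M κ θ : ℕ} (h : θ ≤ κ) (y' : Row (M + 1) θ) (x' : Row (M + 1) κ) :
    ∃ x y, RGraph x y y' x' := by
  obtain ⟨P, hP⟩ := exists_isProfile (fun i => (x'.mult (-i) : ℤ)) (fun i => (y'.mult (-i) : ℤ)) θ
    ((Equiv.sum_comp (Equiv.neg _) (fun i => (y'.mult i : ℤ))).trans y'.sum_mult_int)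
    (by
      refine le_of_le_of_eq ?_
        ((Equiv.sum_comp (Equiv.neg _) (fun i => (x'.mult i : ℤ))).trans x'.sum_mult_int).symm
      exact_mod_cast h)
  have e : ∀ i : Fin (M + 1), -(-i - 1) - 1 = i := fun i => by abel
  set Q : Fin (M + 1) → ℤ := fun i => P (-i - 1) with hQdef
  have hPQ : P = fun i => Q (-i - 1) := by funext i; simp only [hQdef, e]
  have h1 : ∀ i, (y'.mult i : ℤ) + Q i = min (θ : ℤ) (x'.mult i + Q (i - 1)) := by
    intro i
    have := hP.1 (-i)
    simp only [neg_neg] at this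
    simp only [hQdef]
    rw [this]
    congr 3
    abel
  obtain ⟨y, hy⟩ := exists_row_of_int (k := θ) (fun i => (y'.mult i : ℤ) - Q (i - 1) + Q i)
    (by
      intro i
      have h2 := h1 i
      have h3 := h1 (i - 1)
      omega)
    (by rw [Finset.sum_add_distrib, Finset.sum_sub_distrib, sum_shift, y'.sum_mult_int]; ring)
  obtain ⟨x, hx⟩ := exists_row_of_int (k := κ) (fun i => (x'.mult i : ℤ) - Q i + Q (i - 1))
    (by
      intro i
      have h2 := h1 i
      omega)
    (by rw [Finset.sum_add_distrib, Finset.sum_sub_distrib, sum_shift, x'.sum_mult_int]; ring)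
  have hy2 : ∀ i, (y'.mult i : ℤ) = y.mult i + Q (i - 1) - Q i := fun i => by rw [hy]; ring
  have hx2 : ∀ i, (x'.mult i : ℤ) = x.mult i + Q i - Q (i - 1) := fun i => by rw [hx]; ring
  refine ⟨x, y, Q, hy2, hx2, ?_⟩
  rw [← isProfile_reflect hy2 hx2, ← hPQ]
  exact hP

lemma RGraph.preimage_unique {M κ θ : ℕ} {x₁ x₂ : Row (M + 1) κ} {y₁ y₂ y' : Row (M + 1) θ}
    {x' : Row (M + 1) κ} (h₁ : RGraph x₁ y₁ y' x') (h₂ : RGraph x₂ y₂ y' x') :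
    x₁ = x₂ ∧ y₁ = y₂ := by
  obtain ⟨Q, hy, hx, hQ⟩ := h₁
  obtain ⟨P, hy', hx', hP⟩ := h₂
  rw [← isProfile_reflect hy hx] at hQ
  rw [← isProfile_reflect hy' hx'] at hP
  have hQP := hQ.unique hP
  have e : ∀ i, Q i = P i := by
    intro i
    have := congrFun hQP (-i - 1)
    have e2 : -(-i - 1) - 1 = i := by abel
    simpa only [e2] using this
  constructor <;> ext i
  · have := hx i; have := hx' i; rw [e, e] at *; omega
  · have := hy i; have := hy' i; rw [e, e] at *; omega

/-! ### Compatibility with the Kashiwara operators -/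

lemma Row.replace_mult_int {n k : ℕ} (b : Row n k) (a c : Fin n) (h : b.mult a ≠ 0) (j : Fin n) :
    ((b.replace a c h).mult j : ℤ) =
      b.mult j - (if j = a then 1 else 0) + if j = c then 1 else 0 := by
  simp only [Row.replace]
  by_cases hj : j = a
  · subst hj
    simp only [if_true]
    split_ifs <;> push_cast <;> omega
  · simp only [hj, if_false]
    split_ifs <;> push_cast <;> omega

lemma sub_one_ne_self {M : ℕ} (hM : 1 ≤ M) (i : Fin (M + 1)) : i - 1 ≠ i := by
  intro h
  have h1 : (1 : Fin (M + 1)) = 0 := by simpa using h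
  have := congrArg Fin.val h1
  rw [Fin.val_one', Fin.val_zero, Nat.mod_eq_of_lt (by omega)] at this
  omega

lemma Row.e_eq_none {M k : ℕ} {i : Fin (M + 1)} {b : Row (M + 1) k} (h : b.mult i = 0) :
    b.e i = none := by
  simp [Row.e, h]

lemma Row.e_eq_some {M k : ℕ} {i : Fin (M + 1)} {b : Row (M + 1) k} (h : b.mult i ≠ 0) :
    b.e i = some (b.replace i (i - 1) h) := by
  simp [Row.e, h]

lemma tensorE_left {M k l : ℕ} {i : Fin (M + 1)} {b : Row (M + 1) k} {c : Row (M + 1) l}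
    (h : c.mult i ≤ b.mult (i - 1)) : tensorE i (b, c) = (b.e i).map fun a => (a, c) :=
  if_pos h

lemma tensorE_right {M k l : ℕ} {i : Fin (M + 1)} {b : Row (M + 1) k} {c : Row (M + 1) l}
    (h : ¬ c.mult i ≤ b.mult (i - 1)) : tensorE i (b, c) = (c.e i).map fun a => (b, a) :=
  if_neg h

/-- The operator changes `Q` at most at the index `i - 1`. The change is -1 if it acts on the left
factor on both sides, 0 if it acts on `x` and on `x'`, and +1 if it acts on `y` and on `x'`; no
other case occurs. -/
lemma RGraph.tensorE {M κ θ : ℕ} (hM : 1 ≤ M) {x x' : Row (M + 1) κ} {y y' : Row (M + 1) θ}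
    (h : RGraph x y y' x') (i : Fin (M + 1)) :
    (tensorE i (x, y) = none ∧ tensorE i (y', x') = none) ∨
      ∃ p q, tensorE i (x, y) = some p ∧ tensorE i (y', x') = some q ∧
        RGraph p.1 p.2 q.1 q.2 := by
  obtain ⟨Q, hy, hx, hQ, i₀, hi₀⟩ := h
  have hne := sub_one_ne_self hM i
  have r1 := hQ i
  have r2 := hQ (i - 1)
  have r3 := hQ (i + 1)
  simp only [add_sub_cancel_right] at r1 r2 r3 hi₀
  have e1 := hy i
  have e2 := hy (i - 1)
  have e3 := hx i
  have e4 := hx (i - 1)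
  by_cases hc : y.mult i ≤ x.mult (i - 1)
  · rw [tensorE_left hc]
    by_cases hs : x.mult i + Q i ≤ θ
    · rw [tensorE_left (by omega)]
      by_cases h0 : x.mult i = 0
      · left
        rw [Row.e_eq_none h0, Row.e_eq_none (by omega)]
        simp
      · right
        have h0' : y'.mult i ≠ 0 := by omega
        rw [Row.e_eq_some h0, Row.e_eq_some h0']
        refine ⟨_, _, rfl, rfl, fun j => Q j - if j = i - 1 then 1 else 0, ?_, ?_, ?_, ?_⟩
        · intro j
          have := hy j
          simp only [Row.replace_mult_int, sub_left_inj]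
          split_ifs <;> omega
        · intro j
          have := hx j
          simp only [Row.replace_mult_int, sub_left_inj]
          split_ifs <;> omega
        · intro j
          have hj := hQ j
          simp only [Row.replace_mult_int, sub_left_inj] at hj ⊢
          split_ifs with h1 h2 h2
          · exact absurd (h2.symm.trans h1) hne
          · subst h1; omega
          · subst h2; omega
          · simpa using hj
        -- Lowering `x i` may destroy saturation at `i`. Then `Q (i - 1) = θ - y i`, and `y i ≤ x (i
        -- - 1)` gives saturation at `i - 1`, where the changes of `x` and `Q` cancel.
        · by_cases h1 : i₀ = i
          · refine ⟨i - 1, ?_⟩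
            subst h1
            simp only [Row.replace_mult_int, if_neg hne, if_true]
            omega
          · refine ⟨i₀, ?_⟩
            simp only [Row.replace_mult_int, if_neg h1]
            split_ifs <;> omega
    · rw [tensorE_right (by omega)]
      right
      have h0 : x.mult i ≠ 0 := by omega
      have h0' : x'.mult i ≠ 0 := by omega
      rw [Row.e_eq_some h0, Row.e_eq_some h0']
      refine ⟨_, _, rfl, rfl, Q, hy, ?_, ?_, ?_⟩
      · intro j
        have := hx j
        simp only [Row.replace_mult_int]
        split_ifs <;> omega
      · intro j
        have hj := hQ j
        simp only [Row.replace_mult_int] at hj ⊢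
        split_ifs with h1 h2 h2
        · exact absurd (h2.symm.trans h1) hne
        · subst h1; omega
        · subst h2; omega
        · simpa using hj
      · refine ⟨i - 1, ?_⟩
        simp only [Row.replace_mult_int, if_neg hne, if_true]
        omega
  · rw [tensorE_right hc, tensorE_right (by omega)]
    right
    have h0 : y.mult i ≠ 0 := by omega
    have h0' : x'.mult i ≠ 0 := by omega
    rw [Row.e_eq_some h0, Row.e_eq_some h0']
    refine ⟨_, _, rfl, rfl, fun j => Q j + if j = i - 1 then 1 else 0, ?_, ?_, ?_, ?_⟩
    · intro j
      have := hy j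
      simp only [Row.replace_mult_int, sub_left_inj]
      split_ifs <;> omega
    · intro j
      have := hx j
      simp only [Row.replace_mult_int, sub_left_inj]
      split_ifs <;> omega
    · intro j
      have hj := hQ j
      simp only [Row.replace_mult_int, sub_left_inj] at hj ⊢
      split_ifs with h1 h2 h2
      · exact absurd (h2.symm.trans h1) hne
      · subst h1; omega
      · subst h2; omega
      · simpa using hj
    · refine ⟨i₀, ?_⟩
      dsimp only
      split_ifs <;> omega

lemma Row.e_eq_some_iff_f {M k : ℕ} (hM : 1 ≤ M) (i : Fin (M + 1)) (b c : Row (M + 1) k) :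
    b.e i = some c ↔ c.f i = some b := by
  have hne := sub_one_ne_self hM i
  unfold Row.e Row.f
  constructor
  · intro h
    split_ifs at h with h0
    obtain rfl := Option.some_injective _ h
    have h1 : (b.replace i (i - 1) h0).mult (i - 1) ≠ 0 := by
      have := b.replace_mult_int i (i - 1) h0 (i - 1)
      rw [if_neg hne, if_pos rfl] at this
      omega
    rw [dif_neg h1]
    congr 1
    ext j
    zify
    rw [Row.replace_mult_int, Row.replace_mult_int]
    ring
  · intro h
    split_ifs at h with h0
    obtain rfl := Option.some_injective _ h
    have h1 : (c.replace (i - 1) i h0).mult i ≠ 0 := by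
      have := c.replace_mult_int (i - 1) i h0 i
      rw [if_neg hne.symm, if_pos rfl] at this
      omega
    rw [dif_neg h1]
    congr 1
    ext j
    zify
    rw [Row.replace_mult_int, Row.replace_mult_int]
    ring

lemma Row.e_apply {M k : ℕ} (hM : 1 ≤ M) {i : Fin (M + 1)} {b c : Row (M + 1) k}
    (h : b.e i = some c) : b.mult i = c.mult i + 1 ∧ c.mult (i - 1) = b.mult (i - 1) + 1 := by
  have hne := sub_one_ne_self hM i
  unfold Row.e at h
  split_ifs at h with h0
  obtain rfl := Option.some_injective _ h
  have h1 := b.replace_mult_int i (i - 1) h0 (i - 1)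
  have h2 := b.replace_mult_int i (i - 1) h0 i
  rw [if_neg hne, if_pos rfl] at h1
  rw [if_neg hne.symm, if_pos rfl] at h2
  omega

lemma tensorE_eq_some_iff_tensorF {M k l : ℕ} (hM : 1 ≤ M) (i : Fin (M + 1))
    (p q : Row (M + 1) k × Row (M + 1) l) :
    tensorE i p = some q ↔ tensorF i q = some p := by
  obtain ⟨b, c⟩ := p
  obtain ⟨b', c'⟩ := q
  have key1 : ∀ h : b.e i = some b', c = c' →
      (c.eps i ≤ b.phi i ↔ c'.eps i < b'.phi i) := by
    rintro h rfl
    have := Row.e_apply hM h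
    simp only [Row.eps, Row.phi]
    omega
  have key2 : ∀ h : c.e i = some c', b = b' →
      (c.eps i ≤ b.phi i ↔ c'.eps i < b'.phi i) := by
    rintro h rfl
    have := Row.e_apply hM h
    simp only [Row.eps, Row.phi]
    omega
  unfold tensorE tensorF
  constructor
  · intro h
    split_ifs at h with h1
    · simp only [Option.map_eq_some_iff, Prod.mk.injEq] at h
      obtain ⟨a, ha, rfl, rfl⟩ := h
      rw [if_pos ((key1 ha rfl).1 h1)]
      simp [(Row.e_eq_some_iff_f hM i _ _).1 ha]
    · simp only [Option.map_eq_some_iff, Prod.mk.injEq] at h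
      obtain ⟨a, ha, rfl, rfl⟩ := h
      rw [if_neg (fun h2 => h1 ((key2 ha rfl).2 h2))]
      simp [(Row.e_eq_some_iff_f hM i _ _).1 ha]
  · intro h
    split_ifs at h with h1
    · simp only [Option.map_eq_some_iff, Prod.mk.injEq] at h
      obtain ⟨a, ha, rfl, rfl⟩ := h
      have ha' := (Row.e_eq_some_iff_f hM i _ _).2 ha
      rw [if_pos ((key1 ha' rfl).2 h1)]
      simp [ha']
    · simp only [Option.map_eq_some_iff, Prod.mk.injEq] at h
      obtain ⟨a, ha, rfl, rfl⟩ := h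
      have ha' := (Row.e_eq_some_iff_f hM i _ _).2 ha
      rw [if_neg (fun h2 => h1 ((key2 ha' rfl).1 h2))]
      simp [ha']

lemma isCrystalIso_of_tensorE {M k l : ℕ} (hM : 1 ≤ M)
    (Ψ : Row (M + 1) k × Row (M + 1) l ≃ Row (M + 1) l × Row (M + 1) k)
    (h : ∀ i p, tensorE i (Ψ p) = (tensorE i p).map Ψ) : IsCrystalIso Ψ := by
  refine fun i p => ⟨h i p, ?_⟩
  ext r
  rw [← tensorE_eq_some_iff_tensorF hM]
  obtain ⟨r, rfl⟩ := Ψ.surjective r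
  rw [h]
  simp [tensorE_eq_some_iff_tensorF hM]

lemma IsCrystalIso.symm {M k l : ℕ}
    {Ψ : Row (M + 1) k × Row (M + 1) l ≃ Row (M + 1) l × Row (M + 1) k} (h : IsCrystalIso Ψ) :
    IsCrystalIso Ψ.symm := by
  intro i p
  obtain ⟨p, rfl⟩ := Ψ.surjective p
  rw [(h i p).1, (h i p).2]
  simp [Function.comp_def]

/-- The combinatorial `R` matrix with the graph `RGraph`. -/
lemma exists_isCrystalIso {M κ θ : ℕ} (hM : 1 ≤ M) (h : θ ≤ κ) :
    ∃ Ψ : Row (M + 1) κ × Row (M + 1) θ ≃ Row (M + 1) θ × Row (M + 1) κ, IsCrystalIso Ψ ∧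
      ∀ x y y' x', RGraph x y y' x' → Ψ (x, y) = (y', x') := by
  have hex : ∀ p : Row (M + 1) κ × Row (M + 1) θ, ∃ q : Row (M + 1) θ × Row (M + 1) κ,
      RGraph p.1 p.2 q.1 q.2 := by
    intro p
    obtain ⟨y', x', hp⟩ := RGraph.exists_image h p.1 p.2
    exact ⟨(y', x'), hp⟩
  choose F hF using hex
  have huniq : ∀ x y y' x', RGraph x y y' x' → F (x, y) = (y', x') := fun x y y' x' hr =>
    Prod.ext_iff.2 ((hF (x, y)).image_unique hr)
  have hbij : Function.Bijective F := by
    constructor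
    · intro p q hpq
      have hq := hF q
      rw [← hpq] at hq
      exact Prod.ext_iff.2 ((hF p).preimage_unique hq)
    · rintro ⟨y', x'⟩
      obtain ⟨x, y, hr⟩ := RGraph.exists_preimage h y' x'
      exact ⟨(x, y), huniq _ _ _ _ hr⟩
  refine ⟨Equiv.ofBijective F hbij, isCrystalIso_of_tensorE hM _ ?_, huniq⟩
  intro i p
  simp only [Equiv.ofBijective_apply]
  rcases (hF p).tensorE hM i with ⟨h1, h2⟩ | ⟨a, b, h1, h2, h3⟩
  · rw [Prod.mk.eta] at h1 h2
    rw [h1, h2]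
    rfl
  · rw [Prod.mk.eta] at h1 h2
    rw [h1, h2]
    simp [huniq _ _ _ _ h3]

/-! ### The R matrix on three letters -/

/-- The row has `c₂` second letters, `c₃` third letters, and first letters otherwise. -/
def Row.HasBalls {M k : ℕ} (b : Row (M + 1) k) (c₂ c₃ : ℤ) : Prop :=
  ∀ j, (b.mult j : ℤ) =
    if j.val = 0 then k - c₂ - c₃ else if j.val = 1 then c₂ else if j.val = 2 then c₃ else 0

lemma Row.exists_hasBalls {M k : ℕ} (hM : 1 ≤ M) {c₂ c₃ : ℤ} (h₂ : 0 ≤ c₂) (h₃ : 0 ≤ c₃)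
    (hk : c₂ + c₃ ≤ k) (hM' : 2 ≤ M ∨ c₃ = 0) : ∃ b : Row (M + 1) k, b.HasBalls c₂ c₃ := by
  apply exists_row_of_int
  · intro j
    split_ifs <;> omega
  · match M, hM, hM' with
    | 1, _, h =>
      obtain rfl : c₃ = 0 := by omega
      simp [Fin.sum_univ_two]
    | m + 2, _, _ =>
      rw [Fin.sum_univ_succ, Fin.sum_univ_succ, Fin.sum_univ_succ]
      rw [Finset.sum_eq_zero (fun j _ => ?_)]
      · have h : 2 % (m + 2 + 1) = 2 := Nat.mod_eq_of_lt (by omega)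
        simp [h]
      · simp [Fin.val_succ]

lemma Row.HasBalls.ext {M k : ℕ} {b b' : Row (M + 1) k} {c₂ c₃ : ℤ} (h : b.HasBalls c₂ c₃)
    (h' : b'.HasBalls c₂ c₃) : b = b' := by
  ext j
  have := h j
  have := h' j
  omega

lemma Row.hasBalls_u {M k : ℕ} : (Row.u M k).HasBalls 0 0 := by
  intro j
  simp only [Row.u, Fin.ext_iff, Fin.val_zero]
  split_ifs <;> simp

lemma Fin.val_sub_one {M : ℕ} (hM : 1 ≤ M) (j : Fin (M + 1)) :
    (j - 1).val = if j.val = 0 then M else j.val - 1 := by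
  rw [Fin.val_sub, Fin.val_one', Nat.mod_eq_of_lt (by omega : 1 < M + 1)]
  have := j.isLt
  split_ifs with h
  · rw [h, Nat.mod_eq_of_lt (by omega)]; omega
  · rw [show M + 1 - 1 + j.val = (j.val - 1) + (M + 1) by omega, Nat.add_mod_right,
      Nat.mod_eq_of_lt (by omega)]

/-- The combinatorial `R` matrix on three letters, for a carrier with room for all the balls. -/
lemma rMatrixMaps_of_hasBalls {M κ θ : ℕ} (hM : 1 ≤ M) {v v' : Row (M + 1) κ}
    {b b' : Row (M + 1) θ} {a₂ a₃ b₂ b₃ b₂' b₃' : ℤ} (hv : v.HasBalls a₂ a₃)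
    (hb : b.HasBalls b₂ b₃) (hb' : b'.HasBalls b₂' b₃')
    (hv' : v'.HasBalls (a₂ + b₂ - b₂') (a₃ + b₃ - b₃')) (ha₂ : 0 ≤ a₂) (ha₃ : 0 ≤ a₃)
    (hb₃ : 0 ≤ b₃) (hθ : b₂ + b₃ ≤ θ) (hκ : a₂ + a₃ + b₂ + b₃ ≤ κ)
    (hM' : 2 ≤ M ∨ (a₃ = 0 ∧ b₃ = 0)) (h₃ : b₃' = min a₃ (θ - b₂ - b₃))
    (h₂ : b₂' + b₃' = min (a₂ + a₃) (min (a₂ + θ - b₂ - b₃) (θ - b₂))) :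
    RMatrixMaps v b b' v' := by
  -- The profile is explicit and saturated at index 0, since the carrier has at least as many 1s as
  -- the box has 2s and 3s.
  set Q : Fin (M + 1) → ℤ := fun j =>
    if j.val = 0 then b₂' + b₃' else if j.val = 1 then b₃' + b₂ else b₂ + b₃ with hQ
  have hQ' : ∀ j : Fin (M + 1), Q (j - 1) = if j.val = 0 then b₂ + b₃ else
      if j.val = 1 then b₂' + b₃' else if j.val = 2 then b₃' + b₂ else b₂ + b₃ := by
    intro j
    simp only [hQ, Fin.val_sub_one hM]
    split_ifs <;> omega
  rcases le_or_gt θ κ with h | h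
  · obtain ⟨Ψ, hΨ, hgraph⟩ := exists_isCrystalIso (κ := κ) (θ := θ) hM h
    refine ⟨Ψ, hΨ, hgraph _ _ _ _ ⟨Q, fun j => ?_, fun j => ?_, fun j => ?_, 0, ?_⟩⟩
    · rw [hb, hb', hQ']; simp only [hQ]; split_ifs <;> omega
    · rw [hv, hv', hQ']; simp only [hQ]; split_ifs <;> omega
    · beta_reduce; rw [hb, hv, hQ']; simp only [hQ]; split_ifs <;> omega
    · beta_reduce; rw [hv]; simp only [hQ, Fin.val_zero, if_true]; omega
  -- For a box larger than the carrier the same profile shows that the isomorphism in the other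
  -- direction sends `b' ⊗ v'` to `v ⊗ b`; its inverse is used.
  · obtain ⟨Ψ, hΨ, hgraph⟩ := exists_isCrystalIso (κ := θ) (θ := κ) hM h.le
    refine ⟨Ψ.symm, hΨ.symm, Ψ.symm_apply_eq.2 (Eq.symm (hgraph _ _ _ _
      ⟨Q, fun j => ?_, fun j => ?_, fun j => ?_, 0, ?_⟩))⟩
    · rw [hv, hv', hQ']; simp only [hQ]; split_ifs <;> omega
    · rw [hb, hb', hQ']; simp only [hQ]; split_ifs <;> omega
    · beta_reduce; rw [hb', hv', hQ']; simp only [hQ]; split_ifs <;> omega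
    · beta_reduce; rw [hb']; simp only [hQ, Fin.val_zero, if_true]; omega

/-! ### Ultradiscrete tau functions and bilinear identities -/

/-- The ultradiscrete tau function of two solitons with phases `ξ`, `η` and phase shift `δ`. -/
def tau (δ ξ η : ℤ) : ℤ := max (max 0 ξ) (max η (ξ + η - δ))

lemma tau_ge (δ ξ η : ℤ) :
    0 ≤ tau δ ξ η ∧ ξ ≤ tau δ ξ η ∧ η ≤ tau δ ξ η ∧ ξ + η - δ ≤ tau δ ξ η := by
  unfold tau; omega

lemma tau_eq (δ ξ η : ℤ) :
    tau δ ξ η = 0 ∨ tau δ ξ η = ξ ∨ tau δ ξ η = η ∨ tau δ ξ η = ξ + η - δ := by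
  unfold tau; omega

section Hirota

variable {l k s θ a c : ℤ}

/-- `a` and `c` are the effective capacities, for solitons of lengths `l` and `k`, of a box of
capacity `θ`. -/
lemma min_cases (hkl : k < l) (ha : a = min θ l) (hc : c = min θ k) :
    (a = θ ∧ c = θ ∧ θ ≤ k) ∨ (a = θ ∧ c = k ∧ k < θ ∧ θ ≤ l) ∨ (a = l ∧ c = k ∧ l < θ) := by
  omega

/-- In terms of letter counts this is the rule for the third letter, `b₃' = min a₃ (θ - b₂ - b₃)`:
the two terms of the maximum correspond to the two terms of the minimum. -/
lemma hirota_first (hs : 0 ≤ s) (hsk : s ≤ k) (hkl : k < l) (hθ : 1 ≤ θ) (ha : a = min θ l)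
    (hc : c = min θ k) (ξ η : ℤ) :
    tau (2 * k) (ξ - a + s) (η - c + s) + tau (2 * k - s) (ξ - l) (η - k) =
      max (tau (2 * k) (ξ - l + s) (η - k + s) + tau (2 * k - s) (ξ - a) (η - c))
        (tau (2 * k) (ξ + s) (η + s) + tau (2 * k - s) (ξ - a - l) (η - c - k) - θ) := by
  have h := min_cases hkl ha hc
  clear ha hc
  have A := tau_ge (2 * k) (ξ - a + s) (η - c + s)
  have B := tau_ge (2 * k - s) (ξ - l) (η - k)
  have C := tau_ge (2 * k) (ξ - l + s) (η - k + s)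
  have D := tau_ge (2 * k - s) (ξ - a) (η - c)
  have E := tau_ge (2 * k) (ξ + s) (η + s)
  have F := tau_ge (2 * k - s) (ξ - a - l) (η - c - k)
  -- In each inequality `tau_eq` names the maximal terms on the side to be bounded and `tau_ge`
  -- bounds the other side below; every capacity regime then becomes linear.
  apply le_antisymm
  · have A' := tau_eq (2 * k) (ξ - a + s) (η - c + s)
    have B' := tau_eq (2 * k - s) (ξ - l) (η - k)
    rw [le_max_iff]
    by_contra! hcon
    rcases h with h | h | h <;> rcases A' with A' | A' | A' | A' <;>
      rcases B' with B' | B' | B' | B' <;> omega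
  · apply max_le
    · have C' := tau_eq (2 * k) (ξ - l + s) (η - k + s)
      have D' := tau_eq (2 * k - s) (ξ - a) (η - c)
      rcases h with h | h | h <;> rcases C' with C' | C' | C' | C' <;>
        rcases D' with D' | D' | D' | D' <;> omega
    · have E' := tau_eq (2 * k) (ξ + s) (η + s)
      have F' := tau_eq (2 * k - s) (ξ - a - l) (η - c - k)
      rcases h with h | h | h <;> rcases E' with E' | E' | E' | E' <;>
        rcases F' with F' | F' | F' | F' <;> omega

/-- This is the rule for the second letter, `b₂' = min a₂ (θ - b₂ - b₃')`, once the third letters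
have moved. -/
lemma hirota_second (hs : 0 ≤ s) (hsk : s ≤ k) (hkl : k < l) (hθ : 1 ≤ θ) (ha : a = min θ l)
    (hc : c = min θ k) (ξ η : ℤ) :
    tau (2 * k - s) (ξ - a + l) (η - c + k) + tau (2 * k) (ξ - l + s) (η - k + s) =
      max (tau (2 * k - s) ξ η + tau (2 * k) (ξ - a + s) (η - c + s))
        (tau (2 * k - s) (ξ + l) (η + k) + tau (2 * k) (ξ - a - l + s) (η - c - k + s) - θ) := by
  have h := min_cases hkl ha hc
  clear ha hc
  have A := tau_ge (2 * k - s) (ξ - a + l) (η - c + k)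
  have B := tau_ge (2 * k) (ξ - l + s) (η - k + s)
  have C := tau_ge (2 * k - s) ξ η
  have D := tau_ge (2 * k) (ξ - a + s) (η - c + s)
  have E := tau_ge (2 * k - s) (ξ + l) (η + k)
  have F := tau_ge (2 * k) (ξ - a - l + s) (η - c - k + s)
  apply le_antisymm
  · have A' := tau_eq (2 * k - s) (ξ - a + l) (η - c + k)
    have B' := tau_eq (2 * k) (ξ - l + s) (η - k + s)
    rw [le_max_iff]
    by_contra! hcon
    rcases h with h | h | h <;> rcases A' with A' | A' | A' | A' <;>
      rcases B' with B' | B' | B' | B' <;> omega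
  · apply max_le
    · have C' := tau_eq (2 * k - s) ξ η
      have D' := tau_eq (2 * k) (ξ - a + s) (η - c + s)
      rcases h with h | h | h <;> rcases C' with C' | C' | C' | C' <;>
        rcases D' with D' | D' | D' | D' <;> omega
    · have E' := tau_eq (2 * k - s) (ξ + l) (η + k)
      have F' := tau_eq (2 * k) (ξ - a - l + s) (η - c - k + s)
      rcases h with h | h | h <;> rcases E' with E' | E' | E' | E' <;>
        rcases F' with F' | F' | F' | F' <;> omega

end Hirota

/-! ### Letter counts of the two-soliton solution -/

section Balls

variable {l k s θ a c : ℤ}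

/-- The number of second letters to the right of a point at which the solitons of lengths `l`
and `k` have the phases `ξ` and `η`. -/
def secondRight (l k s ξ η : ℤ) : ℤ :=
  tau (2 * k - s) ξ η - tau (2 * k) (ξ - l + s) (η - k + s)

/-- The number of third letters to the right of a point at which the solitons of lengths `l`
and `k` have the phases `ξ` and `η`. -/
def thirdRight (l k s ξ η : ℤ) : ℤ :=
  tau (2 * k) (ξ - l + s) (η - k + s) - tau (2 * k - s) (ξ - l) (η - k)

lemma thirdRight_zero (l k ξ η : ℤ) : thirdRight l k 0 ξ η = 0 := by
  simp [thirdRight]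

lemma balls_nonneg (hs : 0 ≤ s) (hsk : s ≤ k) (hkl : k < l) (ξ η : ℤ) :
    0 ≤ secondRight l k s ξ η + thirdRight l k s ξ η := by
  unfold secondRight thirdRight tau
  omega

lemma balls_le (hs : 0 ≤ s) (hsk : s ≤ k) (hkl : k < l) (ξ η : ℤ) :
    secondRight l k s ξ η + thirdRight l k s ξ η ≤ l + k := by
  unfold secondRight thirdRight tau
  omega

/-- Monotonicity in space and in time is what makes the differences genuine multiplicities, of boxes
and of carriers respectively. -/
lemma secondRight_space_mono (hs : 0 ≤ s) (hsk : s ≤ k) (hkl : k < l) (hθ : 1 ≤ θ)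
    (ha : a = min θ l) (hc : c = min θ k) (ξ η : ℤ) :
    secondRight l k s (ξ - a) (η - c) ≤ secondRight l k s ξ η := by
  have h := min_cases hkl ha hc
  clear ha hc
  unfold secondRight
  have A := tau_eq (2 * k - s) (ξ - a) (η - c)
  have B := tau_eq (2 * k) (ξ - l + s) (η - k + s)
  have C := tau_ge (2 * k - s) ξ η
  have D := tau_ge (2 * k) (ξ - a - l + s) (η - c - k + s)
  rcases h with h | h | h <;> rcases A with A | A | A | A <;> rcases B with B | B | B | B <;> omega

lemma thirdRight_space_mono (hs : 0 ≤ s) (hsk : s ≤ k) (hkl : k < l) (hθ : 1 ≤ θ)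
    (ha : a = min θ l) (hc : c = min θ k) (ξ η : ℤ) :
    thirdRight l k s (ξ - a) (η - c) ≤ thirdRight l k s ξ η := by
  have h := min_cases hkl ha hc
  clear ha hc
  unfold thirdRight
  have A := tau_eq (2 * k) (ξ - a - l + s) (η - c - k + s)
  have B := tau_eq (2 * k - s) (ξ - l) (η - k)
  have C := tau_ge (2 * k) (ξ - l + s) (η - k + s)
  have D := tau_ge (2 * k - s) (ξ - a - l) (η - c - k)
  rcases h with h | h | h <;> rcases A with A | A | A | A <;> rcases B with B | B | B | B <;> omega

lemma secondRight_time_mono (hs : 0 ≤ s) (hsk : s ≤ k) (hkl : k < l) (ξ η : ℤ) :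
    secondRight l k s ξ η ≤ secondRight l k s (ξ + l) (η + k) := by
  unfold secondRight
  have A := tau_eq (2 * k - s) ξ η
  have B := tau_eq (2 * k) (ξ + l - l + s) (η + k - k + s)
  have C := tau_ge (2 * k - s) (ξ + l) (η + k)
  have D := tau_ge (2 * k) (ξ - l + s) (η - k + s)
  rcases A with A | A | A | A <;> rcases B with B | B | B | B <;> omega

lemma thirdRight_time_mono (hs : 0 ≤ s) (hsk : s ≤ k) (hkl : k < l) (ξ η : ℤ) :
    thirdRight l k s ξ η ≤ thirdRight l k s (ξ + l) (η + k) := by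
  unfold thirdRight
  have A := tau_eq (2 * k) (ξ - l + s) (η - k + s)
  have B := tau_eq (2 * k - s) (ξ + l - l) (η + k - k)
  have C := tau_ge (2 * k) (ξ + l - l + s) (η + k - k + s)
  have D := tau_ge (2 * k - s) (ξ - l) (η - k)
  rcases A with A | A | A | A <;> rcases B with B | B | B | B <;> omega

/-- The box is not overfilled: in the sum of the two counts the middle `tau` cancels, leaving a
second difference of a single `tau`. -/
lemma balls_space_le (hs : 0 ≤ s) (hsk : s ≤ k) (hkl : k < l) (hθ : 1 ≤ θ)
    (ha : a = min θ l) (hc : c = min θ k) (ξ η : ℤ) :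
    secondRight l k s ξ η + thirdRight l k s ξ η -
      (secondRight l k s (ξ - a) (η - c) + thirdRight l k s (ξ - a) (η - c)) ≤ θ := by
  have h := min_cases hkl ha hc
  clear ha hc
  unfold secondRight thirdRight
  have A := tau_eq (2 * k - s) ξ η
  have B := tau_eq (2 * k - s) (ξ - a - l) (η - c - k)
  have C := tau_ge (2 * k - s) (ξ - a) (η - c)
  have D := tau_ge (2 * k - s) (ξ - l) (η - k)
  rcases h with h | h | h <;> rcases A with A | A | A | A <;> rcases B with B | B | B | B <;> omega

lemma balls_far_left (hs : 0 ≤ s) (hsk : s ≤ k) (hkl : k < l) {ξ η : ℤ} (hξ : 4 * l ≤ ξ)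
    (hη : 4 * l ≤ η) : secondRight l k s ξ η = l + k - s ∧ thirdRight l k s ξ η = s := by
  unfold secondRight thirdRight tau
  omega

lemma balls_far_right (hs : 0 ≤ s) (hsk : s ≤ k) (hkl : k < l) {ξ η : ℤ} (hξ : ξ ≤ 0)
    (hη : η ≤ 0) : secondRight l k s ξ η = 0 ∧ thirdRight l k s ξ η = 0 := by
  unfold secondRight thirdRight tau
  omega

end Balls

/-- The local update of the two-soliton solution. -/
lemma rMatrixMaps_balls {M κ θ l k s : ℕ} (hM : 1 ≤ M) (hsk : s ≤ k) (hkl : k < l) (hθ : 1 ≤ θ)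
    (hM' : 2 ≤ M ∨ s = 0) (hκ : l + k ≤ κ) {a c : ℤ} (ha : a = min (θ : ℤ) l)
    (hc : c = min (θ : ℤ) k) {v v' : Row (M + 1) κ} {b b' : Row (M + 1) θ} (ξ η : ℤ)
    (hv : v.HasBalls (secondRight l k s (ξ + l) (η + k) - secondRight l k s ξ η)
      (thirdRight l k s (ξ + l) (η + k) - thirdRight l k s ξ η))
    (hb : b.HasBalls (secondRight l k s ξ η - secondRight l k s (ξ - a) (η - c))
      (thirdRight l k s ξ η - thirdRight l k s (ξ - a) (η - c)))
    (hb' : b'.HasBalls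
      (secondRight l k s (ξ + l) (η + k) - secondRight l k s (ξ - a + l) (η - c + k))
      (thirdRight l k s (ξ + l) (η + k) - thirdRight l k s (ξ - a + l) (η - c + k)))
    (hv' : v'.HasBalls
      (secondRight l k s (ξ - a + l) (η - c + k) - secondRight l k s (ξ - a) (η - c))
      (thirdRight l k s (ξ - a + l) (η - c + k) - thirdRight l k s (ξ - a) (η - c))) :
    RMatrixMaps v b b' v' := by
  have hs : (0 : ℤ) ≤ s := by positivity
  have hsk' : (s : ℤ) ≤ k := by exact_mod_cast hsk
  have hkl' : (k : ℤ) < l := by exact_mod_cast hkl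
  have hθ' : (1 : ℤ) ≤ θ := by exact_mod_cast hθ
  have hκ' : (l : ℤ) + k ≤ κ := by exact_mod_cast hκ
  refine rMatrixMaps_of_hasBalls hM hv hb hb' ?_
    (sub_nonneg.2 (secondRight_time_mono hs hsk' hkl' ξ η))
    (sub_nonneg.2 (thirdRight_time_mono hs hsk' hkl' ξ η))
    (sub_nonneg.2 (thirdRight_space_mono hs hsk' hkl' hθ' ha hc ξ η)) ?_ ?_ ?_ ?_ ?_
  · convert hv' using 1 <;> ring
  · have := balls_space_le hs hsk' hkl' hθ' ha hc ξ η
    linarith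
  · have h1 := balls_le hs hsk' hkl' (ξ + l) (η + k)
    have h2 := balls_nonneg hs hsk' hkl' (ξ - a) (η - c)
    linarith
  · rcases hM' with h | rfl
    · exact Or.inl h
    · right
      simp [thirdRight_zero]
  · have h := hirota_first hs hsk' hkl' hθ' ha hc ξ η
    unfold secondRight thirdRight
    simp only [add_sub_cancel_right]
    omega
  -- Adding `b₃'` to `min a₂ (θ - b₂ - b₃')` and expanding the minimum for `b₃'` produces the three
  -- terms.
  · have h := hirota_first hs hsk' hkl' hθ' ha hc ξ η
    have h' := hirota_second hs hsk' hkl' hθ' ha hc ξ η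
    unfold secondRight thirdRight
    simp only [add_sub_cancel_right]
    omega

/-! ### Box positions and phases -/

section BoxStart

lemma boxStart_succ (θ : ℤ → ℕ) (n : ℤ) : boxStart θ (n + 1) = boxStart θ n + θ n := by
  unfold boxStart
  rcases le_or_gt 0 n with h | h
  · rw [Finset.Ico_eq_empty (by omega : ¬ n + 1 < 0), Finset.Ico_eq_empty (by omega : ¬ n < 0)]
    have : Finset.Ico 0 (n + 1) = insert n (Finset.Ico 0 n) := by
      ext j; simp only [Finset.mem_Ico, Finset.mem_insert]; omega
    rw [this, Finset.sum_insert (by simp)]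
    ring
  · rw [Finset.Ico_eq_empty (by omega : ¬ 0 < n + 1), Finset.Ico_eq_empty (by omega : ¬ 0 < n)]
    have : Finset.Ico n 0 = insert n (Finset.Ico (n + 1) 0) := by
      ext j; simp only [Finset.mem_Ico, Finset.mem_insert]; omega
    rw [this, Finset.sum_insert (by simp)]
    ring

lemma boxStart_zero (θ : ℤ → ℕ) : boxStart θ 0 = 0 := by
  simp [boxStart]

lemma boxStart_add_le {θ : ℤ → ℕ} (hθ : ∀ n, 1 ≤ θ n) {m n : ℤ} (h : m ≤ n) :
    boxStart θ m + (n - m) ≤ boxStart θ n := by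
  induction n, h using Int.leInduction with
  | base => simp
  | succ n _ ih =>
    rw [boxStart_succ]
    have := hθ n
    omega

lemma one_le_min_left {θ : ℤ → ℕ} (hθ : ∀ n, 1 ≤ θ n) {c : ℕ} (hc : 1 ≤ c) (n : ℤ) :
    1 ≤ min (θ n) c :=
  le_min (hθ n) hc

end BoxStart

/-- The phase at the left end of the `n`-th box and at time `t` of a soliton of length `c`. -/
noncomputable def phase (θ : ℤ → ℕ) (c : ℕ) (C : ℤ) (n t : ℤ) : ℤ :=
  C + c * t - boxStart (fun j => min (θ j) c) n

lemma phase_succ_space (θ : ℤ → ℕ) (c : ℕ) (C n t : ℤ) :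
    phase θ c C (n + 1) t = phase θ c C n t - min (θ n : ℤ) c := by
  unfold phase
  rw [boxStart_succ]
  push_cast
  ring

lemma phase_succ_time (θ : ℤ → ℕ) (c : ℕ) (C n t : ℤ) :
    phase θ c C n (t + 1) = phase θ c C n t + c := by
  unfold phase
  ring

lemma phase_add_le {θ : ℤ → ℕ} (hθ : ∀ n, 1 ≤ θ n) {c : ℕ} (hc : 1 ≤ c) (C t : ℤ) {m n : ℤ}
    (h : m ≤ n) : phase θ c C n t + (n - m) ≤ phase θ c C m t := by
  have := boxStart_add_le (one_le_min_left hθ hc) h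
  unfold phase
  linarith

/-- The two-soliton solution at time `t`. -/
def IsSolution {M : ℕ} {θ : ℤ → ℕ} (l k s : ℕ) (C₁ C₂ t : ℤ) (p : State M θ) : Prop :=
  ∀ n, (p n).HasBalls
    (secondRight l k s (phase θ l C₁ n t) (phase θ k C₂ n t) -
      secondRight l k s (phase θ l C₁ (n + 1) t) (phase θ k C₂ (n + 1) t))
    (thirdRight l k s (phase θ l C₁ n t) (phase θ k C₂ n t) -
      thirdRight l k s (phase θ l C₁ (n + 1) t) (phase θ k C₂ (n + 1) t))

/-! ### Time evolution of the solution -/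

section Evolution

variable {M l k s κ : ℕ} {θ : ℤ → ℕ}

lemma exists_isSolution (hM : 1 ≤ M) (hsk : s ≤ k) (hkl : k < l) (hθ : ∀ n, 1 ≤ θ n)
    (hM' : 2 ≤ M ∨ s = 0) (C₁ C₂ t : ℤ) : ∃ p : State M θ, IsSolution l k s C₁ C₂ t p := by
  have hs : (0 : ℤ) ≤ s := by positivity
  have hsk' : (s : ℤ) ≤ k := by exact_mod_cast hsk
  have hkl' : (k : ℤ) < l := by exact_mod_cast hkl
  suffices h : ∀ n, ∃ b : Row (M + 1) (θ n), b.HasBalls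
      (secondRight l k s (phase θ l C₁ n t) (phase θ k C₂ n t) -
        secondRight l k s (phase θ l C₁ (n + 1) t) (phase θ k C₂ (n + 1) t))
      (thirdRight l k s (phase θ l C₁ n t) (phase θ k C₂ n t) -
        thirdRight l k s (phase θ l C₁ (n + 1) t) (phase θ k C₂ (n + 1) t)) by
    choose p hp using h
    exact ⟨p, hp⟩
  intro n
  have hθ' : (1 : ℤ) ≤ θ n := by exact_mod_cast hθ n
  rw [phase_succ_space, phase_succ_space]
  refine Row.exists_hasBalls hM
    (sub_nonneg.2 (secondRight_space_mono hs hsk' hkl' hθ' rfl rfl _ _))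
    (sub_nonneg.2 (thirdRight_space_mono hs hsk' hkl' hθ' rfl rfl _ _)) ?_ ?_
  · have := balls_space_le hs hsk' hkl' hθ' rfl rfl (phase θ l C₁ n t) (phase θ k C₂ n t)
    linarith
  · rcases hM' with h | rfl
    · exact Or.inl h
    · right
      simp [thirdRight_zero]

/-- The carrier entering box `n` holds the increase over one time step of the counts to the right of
that box. Far to the left these counts are the constant totals and far to the right they vanish, so
the carrier is `u_κ` at both ends. -/
lemma IsSolution.timeStep (hM : 1 ≤ M) (hk : 1 ≤ k) (hsk : s ≤ k) (hkl : k < l)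
    (hθ : ∀ n, 1 ≤ θ n) (hM' : 2 ≤ M ∨ s = 0) (hκ : l + k ≤ κ) {C₁ C₂ t : ℤ} {p q : State M θ}
    (hp : IsSolution l k s C₁ C₂ t p) (hq : IsSolution l k s C₁ C₂ (t + 1) q) :
    TimeStep κ p q := by
  have hs : (0 : ℤ) ≤ s := by positivity
  have hsk' : (s : ℤ) ≤ k := by exact_mod_cast hsk
  have hkl' : (k : ℤ) < l := by exact_mod_cast hkl
  have hκ' : (l : ℤ) + k ≤ κ := by exact_mod_cast hκ
  have hv : ∀ n : ℤ, ∃ v : Row (M + 1) κ, v.HasBalls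
      (secondRight l k s (phase θ l C₁ n t + l) (phase θ k C₂ n t + k) -
        secondRight l k s (phase θ l C₁ n t) (phase θ k C₂ n t))
      (thirdRight l k s (phase θ l C₁ n t + l) (phase θ k C₂ n t + k) -
        thirdRight l k s (phase θ l C₁ n t) (phase θ k C₂ n t)) := by
    intro n
    refine Row.exists_hasBalls hM (sub_nonneg.2 (secondRight_time_mono hs hsk' hkl' _ _))
      (sub_nonneg.2 (thirdRight_time_mono hs hsk' hkl' _ _)) ?_ ?_
    · have h1 := balls_le hs hsk' hkl' (phase θ l C₁ n t + l) (phase θ k C₂ n t + k)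
      have h2 := balls_nonneg hs hsk' hkl' (phase θ l C₁ n t) (phase θ k C₂ n t)
      linarith
    · rcases hM' with h | rfl
      · exact Or.inl h
      · right
        simp [thirdRight_zero]
  choose v hv using hv
  have h0 : ∀ (c : ℕ) (C : ℤ), phase θ c C 0 t = C + c * t := by
    intro c C
    simp [phase, boxStart_zero]
  refine ⟨v, ?_, ?_, fun n => ?_⟩
  · refine (Filter.eventually_le_atBot (min 0 (min (C₁ + l * t - 4 * l) (C₂ + k * t - 4 * l)))).mono
      fun n hn => ?_
    have h1 := phase_add_le hθ (hk.trans hkl.le) C₁ t (m := n) (n := 0) (by omega)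
    have h2 := phase_add_le hθ hk C₂ t (m := n) (n := 0) (by omega)
    rw [h0] at h1 h2
    have h3 := balls_far_left hs hsk' hkl' (ξ := phase θ l C₁ n t) (η := phase θ k C₂ n t)
      (by omega) (by omega)
    have h4 := balls_far_left hs hsk' hkl' (ξ := phase θ l C₁ n t + l)
      (η := phase θ k C₂ n t + k) (by omega) (by omega)
    have h5 := hv n
    rw [h3.1, h3.2, h4.1, h4.2, sub_self, sub_self] at h5
    exact h5.ext Row.hasBalls_u
  · refine (Filter.eventually_ge_atTop (max 0 (max (C₁ + l * t + l) (C₂ + k * t + k)))).mono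
      fun n hn => ?_
    have h1 := phase_add_le hθ (hk.trans hkl.le) C₁ t (m := 0) (n := n) (by omega)
    have h2 := phase_add_le hθ hk C₂ t (m := 0) (n := n) (by omega)
    rw [h0] at h1 h2
    have h3 := balls_far_right hs hsk' hkl' (ξ := phase θ l C₁ n t) (η := phase θ k C₂ n t)
      (by omega) (by omega)
    have h4 := balls_far_right hs hsk' hkl' (ξ := phase θ l C₁ n t + l)
      (η := phase θ k C₂ n t + k) (by omega) (by omega)
    have h5 := hv n
    rw [h3.1, h3.2, h4.1, h4.2, sub_self] at h5
    exact h5.ext Row.hasBalls_u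
  · have hpn := hp n
    have hqn := hq n
    have hvn := hv (n + 1)
    simp only [phase_succ_time, phase_succ_space] at hpn hqn hvn
    exact rMatrixMaps_balls hM hsk hkl (hθ n) hM' hκ rfl rfl _ _ (hv n) hpn hqn hvn

lemma exists_timeEvolution (hM : 1 ≤ M) (hk : 1 ≤ k) (hsk : s ≤ k) (hkl : k < l)
    (hθ : ∀ n, 1 ≤ θ n) (hM' : 2 ≤ M ∨ s = 0) (hκ : l + k ≤ κ) {C₁ C₂ : ℤ} {p : State M θ}
    (hp : IsSolution l k s C₁ C₂ 0 p) {t : ℕ} {q : State M θ}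
    (hq : IsSolution l k s C₁ C₂ t q) : TimeEvolution κ t p q := by
  choose r hr using fun i : ℕ => exists_isSolution hM hsk hkl hθ hM' C₁ C₂ i
  have huniq : ∀ {i : ℤ} {p q : State M θ}, IsSolution l k s C₁ C₂ i p →
      IsSolution l k s C₁ C₂ i q → p = q := fun h h' => funext fun n => (h n).ext (h' n)
  refine ⟨r, huniq (hr 0) hp, huniq (hr t) hq, fun i _ => ?_⟩
  have := hr (i + 1)
  push_cast at this
  exact (hr i).timeStep hM hk hsk hkl hθ hM' hκ this

end Evolution

/-! ### Letter counts of a state given by cells -/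

lemma Row.entries_map_val {M k : ℕ} {b : Row M k} {p q : ℕ} (hb : b.IsTwoLetter p q)
    (hM : 2 ≤ M ∨ (1 ≤ M ∧ q = 0)) :
    b.entries.map Fin.val = List.replicate p 0 ++ List.replicate q 1 := by
  unfold Row.entries
  match M, hM with
  | 1, h =>
    obtain rfl : q = 0 := by omega
    simp [hb.1, List.finRange_succ]
  | m + 2, _ =>
    rw [List.finRange_succ, List.finRange_succ]
    simp only [List.flatMap_cons, List.map_cons, List.map_append, List.map_map]
    have h : ((List.finRange m).map (Fin.succ ∘ Fin.succ)).flatMap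
        (fun a => List.replicate (b.mult a) a) = [] := by
      rw [List.flatMap_eq_nil_iff]
      intro a ha
      obtain ⟨j, _, rfl⟩ := List.mem_map.1 ha
      simp [hb.1]
    rw [h]
    simp [hb.1]

lemma solitonWord_map_val {M k : ℕ} {b : Row M k} {p q : ℕ} (hb : b.IsTwoLetter p q)
    (hM : 2 ≤ M ∨ (1 ≤ M ∧ q = 0)) :
    (solitonWord b).map Fin.val = List.replicate q 2 ++ List.replicate p 1 := by
  unfold solitonWord
  rw [List.map_reverse, List.map_map]
  have h : (Fin.val ∘ Fin.succ : Fin M → ℕ) = (· + 1) ∘ Fin.val := by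
    funext j
    simp
  rw [h, ← List.map_map, Row.entries_map_val hb hM]
  simp

/-- The number of cells from `y` on that lie in `[α, β)`. -/
def cellsRight (α β y : ℤ) : ℤ := max 0 (β - y) - max 0 (α - y)

lemma cellsRight_step {α β : ℤ} (h : α ≤ β) (p : ℤ) :
    (α ≤ p ∧ p < β ∧ cellsRight α β p = cellsRight α β (p + 1) + 1) ∨
      ((p < α ∨ β ≤ p) ∧ cellsRight α β p = cellsRight α β (p + 1)) := by
  unfold cellsRight
  omega

lemma card_filter_eq_sub {w : ℤ → Prop} [DecidablePred w] {R : ℤ → ℤ}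
    (h : ∀ p, R p - R (p + 1) = if w p then 1 else 0) (u : ℤ) (m : ℕ) :
    (((Finset.range m).filter fun j : ℕ => w (u + j)).card : ℤ) = R u - R (u + m) := by
  induction m with
  | zero => simp
  | succ m ih =>
    rw [Finset.range_add_one, Finset.filter_insert]
    have := h (u + m)
    push_cast
    rw [← add_assoc]
    split_ifs at this ⊢ with h1
    · rw [Finset.card_insert_of_notMem (by simp)]
      push_cast
      linarith
    · linarith

lemma twoSoliton_letter {M l k p₁ q₁ p₂ q₂ : ℕ} {b : Row M l} {c : Row M k}
    (hb : b.IsTwoLetter p₁ q₁) (hc : c.IsTwoLetter p₂ q₂)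
    (hM : 2 ≤ M ∨ (1 ≤ M ∧ q₁ = 0 ∧ q₂ = 0)) (x : ℤ) (L : ℕ) (p : ℤ) :
    (if x ≤ p then
      (solitonWord b ++ List.replicate L 0 ++ solitonWord c).getD (p - x).toNat 0
    else 0 : Fin (M + 1)).val =
      if p < x then 0 else if p < x + q₁ then 2 else if p < x + l then 1 else
      if p < x + l + L then 0 else if p < x + l + L + q₂ then 2 else
      if p < x + l + L + k then 1 else 0 := by
  have hl := hb.2
  have hk := hc.2
  by_cases hp : x ≤ p
  · rw [if_pos hp, if_neg (by omega), ← List.getD_map (f := Fin.val), Fin.val_zero,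
      List.map_append, List.map_append, solitonWord_map_val hb (by omega),
      solitonWord_map_val hc (by omega)]
    obtain ⟨d, rfl⟩ : ∃ d : ℕ, p = x + d := ⟨(p - x).toNat, by omega⟩
    simp only [List.map_replicate, Fin.val_zero, add_sub_cancel_left, Int.toNat_natCast,
      List.getD_eq_getElem?_getD, List.getElem?_append, List.getElem?_replicate,
      List.length_append, List.length_replicate]
    split_ifs <;> first | omega | simp
  · rw [if_neg hp, if_pos (by omega)]
    simp

lemma twoSoliton_hasBalls {M l k p₁ q₁ p₂ q₂ : ℕ} {b : Row M l} {c : Row M k}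
    (hb : b.IsTwoLetter p₁ q₁) (hc : c.IsTwoLetter p₂ q₂)
    (hM : 2 ≤ M ∨ (1 ≤ M ∧ q₁ = 0 ∧ q₂ = 0)) (θ : ℤ → ℕ) (x : ℤ) (L : ℕ) {R₂ R₃ : ℤ → ℤ}
    (hR₂ : ∀ y, R₂ y = cellsRight (x + q₁) (x + l) y +
      cellsRight (x + l + L + q₂) (x + l + L + k) y)
    (hR₃ : ∀ y, R₃ y = cellsRight x (x + q₁) y + cellsRight (x + l + L) (x + l + L + q₂) y)
    (n : ℤ) :
    (twoSoliton θ x L b c n).HasBalls (R₂ (boxStart θ n) - R₂ (boxStart θ (n + 1)))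
      (R₃ (boxStart θ n) - R₃ (boxStart θ (n + 1))) := by
  have hl := hb.2
  have hk := hc.2
  set w : ℤ → Fin (M + 1) := fun p =>
    if x ≤ p then
      (solitonWord b ++ List.replicate L 0 ++ solitonWord c).getD (p - x).toNat 0
    else 0
  have hval : ∀ p, (w p).val =
      if p < x then 0 else if p < x + q₁ then 2 else if p < x + l then 1 else
      if p < x + l + L then 0 else if p < x + l + L + q₂ then 2 else
      if p < x + l + L + k then 1 else 0 := twoSoliton_letter hb hc hM x L
  have key : ∀ (j : Fin (M + 1)) (R : ℤ → ℤ),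
      (∀ p, R p - R (p + 1) = if (w p).val = j.val then 1 else 0) →
      ((twoSoliton θ x L b c n).mult j : ℤ) = R (boxStart θ n) - R (boxStart θ (n + 1)) := by
    intro j R hR
    rw [boxStart_succ, ← card_filter_eq_sub hR]
    simp only [twoSoliton, group, Fin.ext_iff]
    rfl
  intro j
  split_ifs with h0 h1 h2
  -- The 1s are the complement, so up to a constant their counting function is minus the cell number
  -- minus the other counts.
  · rw [key j (fun y => - y - R₂ y - R₃ y)]
    · rw [boxStart_succ]; ring
    · intro p
      have e1 := cellsRight_step (α := x) (β := x + q₁) (by omega) p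
      have e2 := cellsRight_step (α := x + q₁) (β := x + l) (by omega) p
      have e3 := cellsRight_step (α := x + l + L) (β := x + l + L + q₂) (by omega) p
      have e4 := cellsRight_step (α := x + l + L + q₂) (β := x + l + L + k) (by omega) p
      have hp := hval p
      generalize (w p).val = z at hp ⊢
      simp only [hR₂, hR₃]
      split_ifs at hp ⊢ <;> omega
  · rw [key j R₂]
    intro p
    have e2 := cellsRight_step (α := x + q₁) (β := x + l) (by omega) p
    have e4 := cellsRight_step (α := x + l + L + q₂) (β := x + l + L + k) (by omega) p
    have hp := hval p
    generalize (w p).val = z at hp ⊢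
    simp only [hR₂]
    split_ifs at hp ⊢ <;> omega
  · rw [key j R₃]
    intro p
    have e1 := cellsRight_step (α := x) (β := x + q₁) (by omega) p
    have e3 := cellsRight_step (α := x + l + L) (β := x + l + L + q₂) (by omega) p
    have hp := hval p
    generalize (w p).val = z at hp ⊢
    simp only [hR₃]
    split_ifs at hp ⊢ <;> omega
  · rw [key j fun _ => 0]
    · simp
    · intro p
      have hp : (w p).val ≤ 2 := by
        rw [hval]
        split_ifs <;> omega
      rw [if_neg (by omega), sub_self]

/-! ### Translation between phases and cell positions -/

lemma exists_lt_le_succ {g : ℤ → ℤ} (hg : ∀ m n, m ≤ n → g m + (n - m) ≤ g n) (Y : ℤ) :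
    ∃ m, g m < Y ∧ Y ≤ g (m + 1) := by
  obtain ⟨m, hm, hmax⟩ := Int.exists_greatest_of_bdd (P := fun m => g m < Y)
    ⟨max 0 (Y - g 0), fun z hz => by
      by_contra hlt
      have := hg 0 z (by omega)
      omega⟩
    ⟨min 0 (Y - g 0 - 1), by
      have := hg (min 0 (Y - g 0 - 1)) 0 (by omega)
      omega⟩
  refine ⟨m, hm, ?_⟩
  by_contra hlt
  have := hmax (m + 1) (by omega)
  omega

section Position

variable {θ : ℤ → ℕ} {c : ℕ}

/-- The soliton in the cells from `X` to `X + c - 1` has the given phase. -/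
lemma clamp_phase (hθ : ∀ n, 1 ≤ θ n) (hc : 1 ≤ c) {C t X m : ℤ}
    (h1 : 1 ≤ X + c - boxStart θ m) (h2 : X + c ≤ boxStart θ (m + 1))
    (h : phase θ c C m t = min (c : ℤ) (X + c - boxStart θ m)) (n : ℤ) :
    min (c : ℤ) (max 0 (phase θ c C n t)) = min (c : ℤ) (max 0 (X + c - boxStart θ n)) := by
  rcases le_or_gt n m with hn | hn
  -- One box to the left, the phase grows by `min θ c` and the cell count by `θ`. Both being
  -- positive, the increments differ only when both results exceed `c`, where clamping hides the
  -- difference.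
  · have key : min (c : ℤ) (phase θ c C n t) = min (c : ℤ) (X + c - boxStart θ n) ∧
        1 ≤ phase θ c C n t ∧ 1 ≤ X + c - boxStart θ n := by
      induction n, hn using Int.leInductionDown with
      | base => omega
      | pred n _ ih =>
        have e1 := phase_succ_space θ c C (n - 1) t
        have e2 := boxStart_succ θ (n - 1)
        rw [sub_add_cancel] at e1 e2
        omega
    omega
  · have e1 := phase_succ_space θ c C m t
    have e2 := phase_add_le hθ hc C t (m := m + 1) (n := n) hn
    have e3 := boxStart_add_le hθ (m := m + 1) (n := n) hn
    have e4 := boxStart_succ θ m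
    omega

lemma exists_phase (hθ : ∀ n, 1 ≤ θ n) (hc : 1 ≤ c) (X : ℤ) :
    ∃ C m, boxStart θ m < X + c ∧ phase θ c C (m + 1) 0 ≤ 0 ∧
      ∀ n, min (c : ℤ) (max 0 (phase θ c C n 0)) = min (c : ℤ) (max 0 (X + c - boxStart θ n)) := by
  obtain ⟨m, h1, h2⟩ := exists_lt_le_succ (fun m n h => boxStart_add_le hθ h) (X + c)
  -- The phase is normalised in the box `m` that contains the last cell of the soliton.
  set C := min (c : ℤ) (X + c - boxStart θ m) + boxStart (fun j => min (θ j) c) m with hC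
  have h : phase θ c C m 0 = min (c : ℤ) (X + c - boxStart θ m) := by
    simp [phase, hC]
  refine ⟨C, m, h1, ?_, clamp_phase hθ hc (by omega) h2 h⟩
  have e1 := phase_succ_space θ c C m 0
  have e2 := boxStart_succ θ m
  omega

lemma exists_position (hθ : ∀ n, 1 ≤ θ n) (hc : 1 ≤ c) (C t : ℤ) :
    ∃ X m, 1 ≤ phase θ c C m t ∧ phase θ c C (m + 1) t ≤ 0 ∧
      boxStart θ m < X + c ∧ X + c ≤ boxStart θ (m + 1) ∧
      ∀ n, min (c : ℤ) (max 0 (phase θ c C n t)) = min (c : ℤ) (max 0 (X + c - boxStart θ n)) := by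
  obtain ⟨m, h1, h2⟩ := exists_lt_le_succ
    (fun m n h => boxStart_add_le (one_le_min_left hθ hc) h) (C + c * t)
  have e1 := phase_succ_space θ c C m t
  have e2 := boxStart_succ θ m
  have h1' : 1 ≤ phase θ c C m t := by unfold phase; omega
  have h2' : phase θ c C (m + 1) t ≤ 0 := by unfold phase; omega
  -- The soliton ends as many cells into box `m` as the phase at the start of that box.
  refine ⟨boxStart θ m + phase θ c C m t - c, m, h1', h2', by omega, by omega,
    clamp_phase (m := m) hθ hc (by omega) (by omega) (by omega)⟩

end Position

/-! ### The solution before and after the collision -/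

section Asymptotics

variable {l k s : ℤ}

/-- Before the collision the soliton of length `k`, with its third letters on the left, is ahead. -/
lemma balls_before_left (hs : 0 ≤ s) (hsk : s ≤ k) (hkl : k < l) {ξ η : ℤ} (hη : 4 * l ≤ η) :
    secondRight l k s ξ η = min l (max 0 (ξ - (2 * k - s))) + (k - s) ∧
      thirdRight l k s ξ η = s := by
  unfold secondRight thirdRight tau
  omega

lemma balls_before_right (hs : 0 ≤ s) (hsk : s ≤ k) (hkl : k < l) {ξ η : ℤ} (hξ : ξ ≤ -4 * l) :
    secondRight l k s ξ η = min (k - s) (min k (max 0 η)) ∧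
      thirdRight l k s ξ η = max 0 (min k (max 0 η) - (k - s)) := by
  unfold secondRight thirdRight tau
  omega

/-- After the collision the soliton of length `l`, now with the third letters, is ahead. -/
lemma balls_after_left (hs : 0 ≤ s) (hsk : s ≤ k) (hkl : k < l) {ξ η : ℤ} (hξ : 4 * l ≤ ξ) :
    secondRight l k s ξ η = min k (max 0 (η - (2 * k - s))) + (l - s) ∧
      thirdRight l k s ξ η = s := by
  unfold secondRight thirdRight tau
  omega

lemma balls_after_right (hs : 0 ≤ s) (hsk : s ≤ k) (hkl : k < l) {ξ η : ℤ} (hη : η ≤ 0) :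
    secondRight l k s ξ η = min (l - s) (min l (max 0 ξ)) ∧
      thirdRight l k s ξ η = max 0 (min l (max 0 ξ) - (l - s)) := by
  unfold secondRight thirdRight tau
  omega

end Asymptotics

lemma phase_add_const (θ : ℤ → ℕ) (c : ℕ) (C d n t : ℤ) :
    phase θ c (C + d) n t = phase θ c C n t + d := by
  unfold phase
  ring

variable {M l k s : ℕ} {θ : ℤ → ℕ}

lemma isSolution_of_twoSoliton {l₁ l₂ p₁ q₁ p₂ q₂ : ℕ} {b : Row M l₁} {c : Row M l₂}
    (hb : b.IsTwoLetter p₁ q₁) (hc : c.IsTwoLetter p₂ q₂)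
    (hM : 2 ≤ M ∨ (1 ≤ M ∧ q₁ = 0 ∧ q₂ = 0)) {x : ℤ} {L : ℕ} {C₁ C₂ t : ℤ}
    (h₂ : ∀ n, secondRight l k s (phase θ l C₁ n t) (phase θ k C₂ n t) =
      cellsRight (x + q₁) (x + l₁) (boxStart θ n) +
        cellsRight (x + l₁ + L + q₂) (x + l₁ + L + l₂) (boxStart θ n))
    (h₃ : ∀ n, thirdRight l k s (phase θ l C₁ n t) (phase θ k C₂ n t) =
      cellsRight x (x + q₁) (boxStart θ n) +
        cellsRight (x + l₁ + L) (x + l₁ + L + q₂) (boxStart θ n)) :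
    IsSolution l k s C₁ C₂ t (twoSoliton θ x L b c) := by
  intro n
  rw [h₂, h₂, h₃, h₃]
  exact twoSoliton_hasBalls hb hc hM θ x L (fun _ => rfl) (fun _ => rfl) n

lemma boxStart_lt {θ : ℤ → ℕ} (hθ : ∀ n, 1 ≤ θ n) {m n : ℤ} (h : boxStart θ m < boxStart θ n) :
    m < n := by
  by_contra! hnm
  have := boxStart_add_le hθ hnm
  omega

/-- While the short soliton is ahead, the long one is seen at `ξ - (2k - s)`, so the constant fitted
to its cells has to be raised by `2k - s`. -/
lemma exists_isSolution_initial (hk : 1 ≤ k) (hsk : s ≤ k) (hkl : k < l) (hM : 1 ≤ M)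
    (hM' : 2 ≤ M ∨ s = 0) (hθ : ∀ n, 1 ≤ θ n) {b₁ : Row M l} {b₂ : Row M k}
    (hb₁ : b₁.IsTwoLetter l 0) (hb₂ : b₂.IsTwoLetter (k - s) s) {p : State M θ}
    (hp : IsSeparatedTwoSoliton (20 * l) b₁ b₂ p) :
    ∃ C₁ C₂, IsSolution l k s C₁ C₂ 0 p := by
  obtain ⟨x, L, rfl, n₁, n₁', n₂, n₂', -, -, hD, -, h1, h2, -⟩ := hp
  have hs : (0 : ℤ) ≤ s := by positivity
  have hsk' : (s : ℤ) ≤ k := by exact_mod_cast hsk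
  have hkl' : (k : ℤ) < l := by exact_mod_cast hkl
  have hl : 1 ≤ l := hk.trans hkl.le
  obtain ⟨C₁, m₁, hm₁, hm₁', hC₁⟩ := exists_phase hθ hl x
  obtain ⟨C₂, -, -, -, hC₂⟩ := exists_phase hθ hk (x + l + L)
  have hm : m₁ < n₁' + 1 := boxStart_lt hθ (hm₁.trans_le h1)
  refine ⟨C₁ + (2 * k - s), C₂, isSolution_of_twoSoliton hb₁ hb₂ (by omega) ?_ ?_⟩ <;>
  · intro n
    have e₁ := hC₁ n
    have e₂ := hC₂ n
    rw [phase_add_const]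
    -- Every box has a cell, so distances in boxes bound phases from below. The split lies in the
    -- gap: to its left `η ≥ 4l`, to its right `ξ ≤ -4l`, and one of the asymptotic forms applies.
    rcases lt_or_ge n (n₂ - 10 * l) with h | h
    · have e₃ := hC₂ n₂
      have e₄ := phase_add_le hθ hk C₂ 0 (m := n) (n := n₂) (by omega)
      have e₅ := boxStart_add_le hθ (m := n) (n := n₂) (by omega)
      have e₆ := balls_before_left hs hsk' hkl' (ξ := phase θ l C₁ n 0 + (2 * k - s))
        (η := phase θ k C₂ n 0) (by omega)
      rw [add_sub_cancel_right] at e₆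
      first | rw [e₆.1] | rw [e₆.2]
      unfold cellsRight
      push_cast
      omega
    · have e₃ := phase_add_le hθ hl C₁ 0 (m := m₁ + 1) (n := n) (by omega)
      have e₄ := boxStart_add_le hθ (m := n₁' + 1) (n := n) (by omega)
      have e₅ := balls_before_right hs hsk' hkl' (ξ := phase θ l C₁ n 0 + (2 * k - s))
        (η := phase θ k C₂ n 0) (by omega)
      first | rw [e₅.1] | rw [e₅.2]
      unfold cellsRight
      push_cast
      omega

/-! ### The long soliton overtakes -/

/-- Crossing a box costs the solitons the times `min θ l / l` and `min θ k / k`. For `θ < l` the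
first is strictly smaller, and by integrality the cross-multiplied gain is at least 1 per box. -/
lemma exists_boxStart_sub_ge (hk : 1 ≤ k) (hkl : k < l) (hθ : ∀ n, 1 ≤ θ n)
    (hfin : {n : ℤ | l ≤ θ n}.Finite) :
    ∃ N E : ℤ, ∀ n, N ≤ n → n - E ≤ l * boxStart (fun j => min (θ j) k) n -
      k * boxStart (fun j => min (θ j) l) n := by
  obtain ⟨N, hN⟩ := hfin.bddAbove
  refine ⟨N + 1, N + 1 - (l * boxStart (fun j => min (θ j) k) (N + 1) -
      k * boxStart (fun j => min (θ j) l) (N + 1)), fun n hn => ?_⟩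
  induction n, hn using Int.leInduction with
  | base => simp
  | succ n hn ih =>
    rw [boxStart_succ _ n, boxStart_succ _ n]
    have h1 : θ n < l := by
      by_contra! h
      have := hN h
      omega
    have h2 : (k : ℤ) * (min (θ n) l : ℕ) + 1 ≤ l * (min (θ n) k : ℕ) := by
      rw [min_eq_left h1.le]
      norm_cast
      rcases le_total (θ n) k with h | h
      · rw [min_eq_left h]
        have := hθ n
        nlinarith
      · rw [min_eq_right h]
        nlinarith
    linarith

lemma boxStart_le_add_mul {θ : ℤ → ℕ} {c : ℕ} (hc : ∀ n, θ n ≤ c) {m n : ℤ} (h : m ≤ n) :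
    boxStart θ n ≤ boxStart θ m + c * (n - m) := by
  induction n, h using Int.leInduction with
  | base => simp
  | succ n _ ih =>
    rw [boxStart_succ]
    have : (θ n : ℤ) ≤ c := by exact_mod_cast hc n
    linarith

/-- The longer soliton eventually leads the shorter one by any number of boxes. -/
lemma exists_time_phase_ge (hk : 1 ≤ k) (hkl : k < l) (hθ : ∀ n, 1 ≤ θ n)
    (hfin : {n : ℤ | l ≤ θ n}.Finite) (C₁ C₂ : ℤ) (E : ℕ) :
    ∃ t : ℕ, 0 < t ∧ ∀ m, 1 ≤ phase θ k C₂ m t → phase θ k C₂ (m + 1) t ≤ 0 →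
      1 ≤ phase θ l C₁ (m + 1 + E) t := by
  obtain ⟨N, F, hF⟩ := exists_boxStart_sub_ge hk hkl hθ hfin
  -- If the long soliton were not `E` boxes ahead of the short one, which ends in box `m`,
  -- eliminating `t` from the two phase inequalities would give `m + 1 ≤ Z`. The time below is large
  -- enough to push `m + 1` beyond both `N` and `Z`, as the effective capacities for the short
  -- soliton are at most `k`.
  set Z : ℤ := F + k * (l * E) - k * C₁ - l * (1 - C₂ - k) with hZ
  have hk' : (1 : ℤ) ≤ k := by exact_mod_cast hk
  refine ⟨(|N| + |C₂| + |Z| + 1).toNat, Int.pos_iff_toNat_pos.1 (by positivity), fun m h1 h2 => ?_⟩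
  have ht : (((|N| + |C₂| + |Z| + 1).toNat : ℕ) : ℤ) = |N| + |C₂| + |Z| + 1 :=
    Int.toNat_of_nonneg (by positivity)
  generalize (|N| + |C₂| + |Z| + 1).toNat = t at *
  have hN := le_abs_self N
  have hN0 := abs_nonneg N
  have hC := neg_abs_le C₂
  have hC0 := abs_nonneg C₂
  have hZ1 := le_abs_self Z
  have hZ0 := abs_nonneg Z
  have e₁ := boxStart_succ (fun j => min (θ j) k) m
  have e₂ : ((min (θ m) k : ℕ) : ℤ) ≤ k := by exact_mod_cast min_le_right _ _
  have e₃ := boxStart_le_add_mul (θ := fun j => min (θ j) l) (c := l)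
    (fun n => min_le_right _ _) (m := m + 1) (n := m + 1 + E) (by omega)
  have h0 := boxStart_zero (fun j => min (θ j) k)
  unfold phase at *
  set Sk := boxStart (fun j => min (θ j) k) (m + 1)
  set Sl := boxStart (fun j => min (θ j) l) (m + 1)
  have hkt : (t : ℤ) ≤ k * t := by nlinarith
  have hm : 0 < m + 1 := by
    apply boxStart_lt (one_le_min_left hθ hk)
    rw [h0]
    change 0 < Sk
    linarith
  have e₄ := boxStart_le_add_mul (θ := fun j => min (θ j) k) (c := k)
    (fun n => min_le_right _ _) hm.le
  rw [h0] at e₄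
  have hmt : (t : ℤ) - |C₂| ≤ m + 1 := by
    by_contra! hlt
    nlinarith
  have hΔ := hF (m + 1) (by linarith)
  by_contra! hlt
  have h3 : (k : ℤ) * (C₁ + l * t - Sl - l * E) ≤ 0 := by
    apply mul_nonpos_of_nonneg_of_nonpos (by linarith)
    rw [add_sub_cancel_left] at e₃
    linarith
  have h4 : (l : ℤ) * (1 - C₂ + Sk - k) ≤ l * (k * t) :=
    mul_le_mul_of_nonneg_left (by linarith) (by positivity)
  have h5 : m + 1 ≤ Z := by
    rw [hZ]
    change m + 1 - F ≤ l * Sk - k * Sl at hΔ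
    linarith
  linarith

lemma exists_time_isSeparatedTwoSoliton (hk : 1 ≤ k) (hsk : s ≤ k) (hkl : k < l) (hM : 1 ≤ M)
    (hM' : 2 ≤ M ∨ s = 0) (hθ : ∀ n, 1 ≤ θ n) (hfin : {n : ℤ | l ≤ θ n}.Finite)
    {c₂ : Row M k} {c₁ : Row M l} (hc₂ : c₂.IsTwoLetter k 0) (hc₁ : c₁.IsTwoLetter (l - s) s)
    (C₁ C₂ : ℤ) (D : ℕ) :
    ∃ t : ℕ, 0 < t ∧ ∃ q : State M θ, IsSolution l k s C₁ C₂ t q ∧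
      IsSeparatedTwoSoliton D c₂ c₁ q := by
  have hs : (0 : ℤ) ≤ s := by positivity
  have hsk' : (s : ℤ) ≤ k := by exact_mod_cast hsk
  have hkl' : (k : ℤ) < l := by exact_mod_cast hkl
  have hl : 1 ≤ l := hk.trans hkl.le
  -- After the collision it is the short soliton that is seen shifted, at `η - (2k - s)`. The lead
  -- `20 * l + D` covers the extent of the long soliton, the room needed for the asymptotic forms,
  -- and the required separation.
  obtain ⟨t, ht, hlead⟩ := exists_time_phase_ge hk hkl hθ hfin C₁ (C₂ + -(2 * k - s))
    (20 * l + D)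
  obtain ⟨X₂, m₂, ha₂, hb₂, hc₂', hd₂, hX₂⟩ := exists_position hθ hk (C₂ + -(2 * k - s)) t
  obtain ⟨X₁, m₁, ha₁, hb₁, hc₁', hd₁, hX₁⟩ := exists_position hθ hl C₁ t
  have hm : m₂ + 1 + (20 * l + D) ≤ m₁ := by
    have h1 := hlead m₂ ha₂ hb₂
    by_contra! hlt
    have h2 := phase_add_le hθ hl C₁ t (m := m₁ + 1) (n := m₂ + 1 + (20 * l + D : ℕ))
      (by push_cast; omega)
    push_cast at h1 h2
    omega
  have hB₁ := boxStart_add_le hθ (m := m₁ - l) (n := m₁) (by omega)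
  have hB₂ := boxStart_add_le hθ (m := m₂ - k) (n := m₂) (by omega)
  have hB₃ := boxStart_add_le hθ (m := m₂ + 1) (n := m₁ - l) (by omega)
  obtain ⟨L, hL⟩ : ∃ L : ℕ, X₁ = X₂ + k + L := ⟨(X₁ - X₂ - k).toNat, by omega⟩
  refine ⟨t, ht, twoSoliton θ X₂ L c₂ c₁, isSolution_of_twoSoliton hc₂ hc₁ (by omega) ?_ ?_,
    -- Each soliton ends in box `m₂` or `m₁`; since boxes are nonempty, going back by its length in
    -- boxes covers it.
    X₂, L, rfl, m₂ - k, m₂, m₁ - l, m₁, by omega, by omega, by omega, by omega, by omega,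
    by omega, by omega⟩ <;>
  · intro n
    have e₁ := hX₁ n
    have e₂ := hX₂ n
    rw [phase_add_const] at e₂
    rcases lt_or_ge n (m₁ - 10 * l) with h | h
    · have e₃ := phase_add_le hθ hl C₁ t (m := n) (n := m₁) (by omega)
      have e₄ := boxStart_add_le hθ (m := n) (n := m₁ - l) (by omega)
      have e₅ := balls_after_left hs hsk' hkl' (ξ := phase θ l C₁ n t)
        (η := phase θ k C₂ n t) (by omega)
      first | rw [e₅.1] | rw [e₅.2]
      unfold cellsRight
      push_cast
      omega
    · have e₃ := phase_add_le hθ hk (C₂ + -(2 * k - s)) t (m := m₂ + 1) (n := n) (by omega)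
      rw [phase_add_const, phase_add_const] at e₃
      rw [phase_add_const] at hb₂
      have e₄ := boxStart_add_le hθ (m := m₂ + 1) (n := n) (by omega)
      have e₅ := balls_after_right hs hsk' hkl' (ξ := phase θ l C₁ n t)
        (η := phase θ k C₂ n t) (by omega)
      first | rw [e₅.1] | rw [e₅.2]
      unfold cellsRight
      push_cast
      omega

end SolitonAutomaton

theorem proposition3p5 (l : ℕ) :
    ∃ K₀ D₀ : ℕ, ∀ (M k h : ℕ), 1 ≤ M → 1 ≤ k → k < l → h ≤ k →
      ∀ (θ : ℤ → ℕ), (∀ n, 1 ≤ θ n) → {n : ℤ | l ≤ θ n}.Finite →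
      ∀ (b₁ : SolitonAutomaton.Row M l) (b₂ : SolitonAutomaton.Row M k)
        (c₂ : SolitonAutomaton.Row M k) (c₁ : SolitonAutomaton.Row M l),
        b₁.IsTwoLetter l 0 → b₂.IsTwoLetter h (k - h) →
        c₂.IsTwoLetter k 0 → c₁.IsTwoLetter (l - k + h) (k - h) →
      ∀ κ : ℕ, K₀ ≤ κ →
      ∀ p : SolitonAutomaton.State M θ, SolitonAutomaton.IsSeparatedTwoSoliton D₀ b₁ b₂ p →
      ∀ D : ℕ, ∃ t : ℕ, 0 < t ∧ ∃ q : SolitonAutomaton.State M θ,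
        SolitonAutomaton.TimeEvolution κ t p q ∧
          SolitonAutomaton.IsSeparatedTwoSoliton D c₂ c₁ q := by
  -- The carrier never holds more than `l + k < 2 * l` balls; `20 * l` is a generous gap for the
  -- asymptotic forms.
  refine ⟨2 * l, 20 * l, ?_⟩
  intro M k h hM hk hkl hhk θ hθ hfin b₁ b₂ c₂ c₁ hb₁ hb₂ hc₂ hc₁ κ hκ p hp D
  -- For `M = 1` the row `b₂` has a single multiplicity, which is both `h` and `k`.
  have hM' : 2 ≤ M ∨ k - h = 0 := by
    rcases hM.lt_or_eq with h1 | rfl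
    · exact Or.inl h1
    · right
      have h1 := b₂.sum_mult
      have h2 := hb₂.1 0
      simp at h1 h2
      omega
  have hsk : k - h ≤ k := Nat.sub_le _ _
  rw [show h = k - (k - h) by omega, Nat.sub_sub_self hsk] at hb₂
  rw [show l - k + h = l - (k - h) by omega] at hc₁
  obtain ⟨C₁, C₂, hp₀⟩ :=
    SolitonAutomaton.exists_isSolution_initial hk hsk hkl hM hM' hθ hb₁ hb₂ hp
  obtain ⟨t, ht, q, hq, hsep⟩ := SolitonAutomaton.exists_time_isSeparatedTwoSoliton hk hsk hkl hM
    hM' hθ hfin hc₂ hc₁ C₁ C₂ D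
  exact ⟨t, ht, q, SolitonAutomaton.exists_timeEvolution hM hk hsk hkl hθ hM' (by omega) hp₀ hq,
    hsep⟩
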